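/- Let $R=(\bigoplus_{n\in\mathbb Z}R^n,d)$ be a dg ring (cohomological grading), and let $\mathrm{dgMod}\,R$ be the category of right dg $R$-modules, whose morphisms are the $R$-linear maps of degree $0$ commuting with the differentials. Assume that $R$ is * bounded: $R^n=0$ for $|n|\gg 0$; * non-positive: $R^n=0$ for $n>0$; * skew-commutative: $ab=(-1)^{|a||b|}ba$ for homogeneous $a,b\in R$; * dg noetherian: every ascending chain of right dg ideals, and every ascending chain of left dg ideals, is stationary. For an abelian category $\mathcal A$, a nonzero object $H$ is *monoform* if for every nonzero subobject $L\subseteq H$ the objects $H$ and $H/L$ have no common nonzero subobject. Two monoform objects are *atom-equivalent* if they have a common nonzero subobject. Let $\mathrm{Spec}\,\mathcal A$ be the set of classes $\overline H$ of monoform objects. For an object $M$, put $\mathrm{Ass}_{\mathcal A}M=\{\overline H\mid H \text{ is a monoform subobject of } M\}$ and $\mathrm{Supp}_{\mathcal A}M=\{\overline H\mid H\text{ is a monoform subquotient of }M\}$; the sets $\mathrm{Supp}_{\mathcal A}M$ form an open basis of the topology of $\mathrm{Spec}\,\mathcal A$. The group $\mathbb Z$ acts on $\mathrm{dgMod}\,R$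 by shifts, hence on $\mathrm{Spec}(\mathrm{dgMod}\,R)$. Let $\pi\colon\mathrm{Spec}(\mathrm{dgMod}\,R)\to\mathrm{Spec}^{\mathbb Z}(\mathrm{dgMod}\,R)$ be the quotient by this action, with the quotient topology, and put $\mathrm{Ass}^{\mathbb Z}M=\pi(\mathrm{Ass}\,M)$, $\mathrm{Supp}^{\mathbb Z}M=\pi(\mathrm{Supp}\,M)$. For an $R^0$-module $H$, let $D(H)=(H\xrightarrow{\mathrm{id}}H)$ be the dg $R$-module concentrated in degrees $-1$ and $0$ in which $a\in R^i$ acts on $x\in D(H)^j$ by $x\cdot a=xa$ if $i=0$, by $x\cdot a=x\,d(a)$ if $i=-1$ and $j=0$, and by $x\cdot a=0$ otherwise. Then: 1. $D(H)$ is monoform for every monoform $R^0$-module $H$, and $\overline H\mapsto\pi(\overline{D(H)})$ is a well-defined bijection $\mathrm{Spec}(\mathrm{Mod}\,R^0)\to\mathrm{Spec}^{\mathbb Z}(\mathrm{dgMod}\,R)$. Under this identification, for every $M\in\mathrm{dgMod}\,R$, $$\mathrm{Ass}^{\mathbb Z}_{\mathrm{dgMod}\,R}(M)=\mathrm{Ass}_{\mathrm{Mod}\,R^0}(M),$$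 where on the right-hand side $M$ is regarded as an $R^0$-module by forgetting the grading and the differential. 2. $\mathrm{dgMod}\,R$ satisfies condition $(*)$: for every $M\in\mathrm{dgMod}\,R$ and every $x\in\mathrm{Supp}^{\mathbb Z}_{\mathrm{dgMod}\,R}(M)$ there exists $y\in\mathrm{Ass}^{\mathbb Z}_{\mathrm{dgMod}\,R}(M)$ lying in the closure of $\{x\}$ in $\mathrm{Spec}^{\mathbb Z}(\mathrm{dgMod}\,R)$. -/

import Mathlib

open CategoryTheory CategoryTheory.Limits MulOpposite

universe v u

noncomputable section

/-! ### Atom spectra -/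

section Atoms

variable {C : Type u} [Category.{v} C]

/-- `X` and `Y` have a common nonzero subobject. -/
def HaveCommonNonzeroSubobject (X Y : C) : Prop :=
  ∃ Z : C, ¬ IsZero Z ∧ (∃ i : Z ⟶ X, Mono i) ∧ (∃ j : Z ⟶ Y, Mono j)

/-- A nonzero object `H` is monoform if, for every nonzero subobject `L` of `H`,
there is no common nonzero subobject of `H` and `H / L`. -/
def IsMonoform [HasZeroMorphisms C] (H : C) : Prop :=
  ¬ IsZero H ∧
    ∀ (L : C) (i : L ⟶ H), Mono i → ¬ IsZero L →
      ∀ (Q : C) (p : H ⟶ Q) (w : i ≫ p = 0), Nonempty (IsColimit (CokernelCofork.ofπ p w)) →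
        ¬ HaveCommonNonzeroSubobject H Q

variable [HasZeroMorphisms C]

variable (C) in
/-- The atom spectrum: monoform objects up to atom-equivalence, where two monoform objects are
atom-equivalent if they have a common nonzero subobject. (In an abelian category this is an
equivalence relation on monoform objects.) -/
def AtomSpectrum : Type u :=
  Quot fun H K : {X : C // IsMonoform X} => HaveCommonNonzeroSubobject H.1 K.1

/-- The atom represented by a monoform object. -/
def AtomSpectrum.mk (H : C) (hH : IsMonoform H) : AtomSpectrum C := Quot.mk _ ⟨H, hH⟩

/-- The atom support: the atoms represented by monoform subquotients (subobjects of quotients). -/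
def atomSupp (M : C) : Set (AtomSpectrum C) :=
  {α | ∃ (H : C) (hH : IsMonoform H), α = AtomSpectrum.mk H hH ∧
    ∃ (Q : C) (p : M ⟶ Q) (i : H ⟶ Q), Epi p ∧ Mono i}

/-- The associated atoms: the atoms represented by monoform subobjects. -/
def atomAss (M : C) : Set (AtomSpectrum C) :=
  {α | ∃ (H : C) (hH : IsMonoform H), α = AtomSpectrum.mk H hH ∧ ∃ i : H ⟶ M, Mono i}

/-- The topology on the atom spectrum with (open basis) the atom supports of all objects. -/
instance : TopologicalSpace (AtomSpectrum C) :=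
  TopologicalSpace.generateFrom (Set.range fun M : C => atomSupp M)

variable [HasShift C ℤ]

/-- The atom `β` is of the form `n · α`, where the group `ℤ` acts by the shift functors. -/
def AtomSpectrum.IsShiftOf (α β : AtomSpectrum C) : Prop :=
  ∃ (H : C) (hH : IsMonoform H) (n : ℤ) (hH' : IsMonoform (H⟦n⟧)),
    α = AtomSpectrum.mk H hH ∧ β = AtomSpectrum.mk (H⟦n⟧) hH'

variable (C) in
/-- The `ℤ`-orbit atom spectrum: the quotient of the atom spectrum by the action of `ℤ` through
the shift functors, with the quotient topology. -/
def OrbitAtomSpectrum : Type u := Quot (AtomSpectrum.IsShiftOf (C := C))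

/-- The quotient map onto the `ℤ`-orbit atom spectrum. -/
def AtomSpectrum.toOrbit (α : AtomSpectrum C) : OrbitAtomSpectrum C := Quot.mk _ α

instance : TopologicalSpace (OrbitAtomSpectrum C) :=
  TopologicalSpace.coinduced AtomSpectrum.toOrbit inferInstance

/-- `Supp^ℤ M`. -/
def orbitSupp (M : C) : Set (OrbitAtomSpectrum C) := AtomSpectrum.toOrbit '' atomSupp M

/-- `Ass^ℤ M`. -/
def orbitAss (M : C) : Set (OrbitAtomSpectrum C) := AtomSpectrum.toOrbit '' atomAss M

variable (C) in
/-- Condition `(*)`: for every object `M` and every `x` in `Supp^ℤ M`, some point of `Ass^ℤ M`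
lies in the closure of `{x}`. -/
def SuppSpecializesFromAss : Prop :=
  ∀ (M : C), ∀ x ∈ orbitSupp M, ∃ y ∈ orbitAss M, y ∈ closure {x}

end Atoms

/-! ### DG rings -/

/-- A dg ring: a `ℤ`-graded ring with a differential of degree `1` satisfying the graded
Leibniz rule. -/
structure DGRing : Type (u + 1) where
  carrier : Type u
  [ring : Ring carrier]
  gr : ℤ → AddSubgroup carrier
  [graded : GradedRing gr]
  d : carrier →+ carrier
  d_mem : ∀ {i : ℤ} {a : carrier}, a ∈ gr i → d a ∈ gr (i + 1)
  d_d : ∀ a, d (d a) = 0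
  leibniz : ∀ {i : ℤ} {a : carrier}, a ∈ gr i → ∀ b,
    d (a * b) = d a * b + (i.negOnePow : ℤ) • (a * d b)

namespace DGRing

attribute [instance] ring graded

variable (R : DGRing.{u})

/-- The degree-zero subring `R⁰`. -/
abbrev Zero : Type u := R.gr 0

/-- The inclusion of `R⁰` into `R`. -/
def zeroIncl : R.Zero →+* R.carrier where
  toFun a := a
  map_one' := rfl
  map_mul' _ _ := rfl
  map_zero' := rfl
  map_add' _ _ := rfl

/-- The homogeneous component of degree `i`. -/
def comp (i : ℤ) : R.carrier →+ R.carrier where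
  toFun a := DirectSum.decompose R.gr a i
  map_zero' := by simp
  map_add' := by simp

/-- `Rⁿ = 0` for `|n| ≫ 0`. -/
def IsBounded : Prop := ∃ N : ℤ, ∀ n : ℤ, N < |n| → R.gr n = ⊥

/-- `Rⁿ = 0` for `n > 0`. -/
def IsNonpositive : Prop := ∀ n : ℤ, 0 < n → R.gr n = ⊥

/-- `a b = (-1)^{|a||b|} b a` for homogeneous `a`, `b`. -/
def IsSkewCommutative : Prop :=
  ∀ (i j : ℤ) (a b : R.carrier), a ∈ R.gr i → b ∈ R.gr j →
    a * b = ((i * j).negOnePow : ℤ) • (b * a)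

/-- Right dg ideals: graded right ideals that are stable under the differential. -/
def IsRightDGIdeal (I : AddSubgroup R.carrier) : Prop :=
  ∀ x ∈ I, (∀ a, x * a ∈ I) ∧ (∀ i, R.comp i x ∈ I) ∧ R.d x ∈ I

/-- Left dg ideals: graded left ideals that are stable under the differential. -/
def IsLeftDGIdeal (I : AddSubgroup R.carrier) : Prop :=
  ∀ x ∈ I, (∀ a, a * x ∈ I) ∧ (∀ i, R.comp i x ∈ I) ∧ R.d x ∈ I

/-- Every ascending chain of right dg ideals is stationary. -/
def IsRightDGNoetherian : Prop :=
  ∀ I : ℕ →o AddSubgroup R.carrier, (∀ n, R.IsRightDGIdeal (I n)) → ∃ n, ∀ m, n ≤ m → I n = I m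

/-- Every ascending chain of left dg ideals is stationary. -/
def IsLeftDGNoetherian : Prop :=
  ∀ I : ℕ →o AddSubgroup R.carrier, (∀ n, R.IsLeftDGIdeal (I n)) → ∃ n, ∀ m, n ≤ m → I n = I m

/-- Left and right dg noetherian. -/
def IsDGNoetherian : Prop := R.IsLeftDGNoetherian ∧ R.IsRightDGNoetherian

end DGRing

/-! ### The category of right dg modules -/

/-- A right dg module over `R`: a graded right `R`-module with a differential of degree `1`
satisfying the graded Leibniz rule. A right module is a module over the opposite ring, so that
`op a • x` is `x · a`. -/
structure DGMod (R : DGRing.{u}) : Type (u + 1) where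
  carrier : Type u
  [addCommGroup : AddCommGroup carrier]
  [module : Module (R.carrier)ᵐᵒᵖ carrier]
  gr : ℤ → AddSubgroup carrier
  isInternal : DirectSum.IsInternal gr
  smul_mem : ∀ {i j : ℤ} {x : carrier} {a : R.carrier},
    x ∈ gr i → a ∈ R.gr j → op a • x ∈ gr (i + j)
  d : carrier →+ carrier
  d_mem : ∀ {i : ℤ} {x : carrier}, x ∈ gr i → d x ∈ gr (i + 1)
  d_d : ∀ x, d (d x) = 0
  leibniz : ∀ {i : ℤ} {x : carrier}, x ∈ gr i → ∀ a : R.carrier,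
    d (op a • x) = op a • d x + (i.negOnePow : ℤ) • (op (R.d a) • x)

namespace DGMod

attribute [instance] addCommGroup module

variable {R : DGRing.{u}}

/-- Homomorphisms of dg modules: `R`-linear maps of degree `0` commuting with the differentials. -/
@[ext]
structure Hom (M N : DGMod R) : Type u where
  toLin : M.carrier →ₗ[(R.carrier)ᵐᵒᵖ] N.carrier
  map_mem : ∀ {i : ℤ} {x : M.carrier}, x ∈ M.gr i → toLin x ∈ N.gr i
  map_d : ∀ x, toLin (M.d x) = N.d (toLin x)

instance : Category (DGMod R) where
  Hom M N := Hom M N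
  id M := ⟨LinearMap.id, fun h => h, fun _ => rfl⟩
  comp f g := ⟨g.toLin ∘ₗ f.toLin, fun h => g.map_mem (f.map_mem h), fun x => by
    simp [f.map_d, g.map_d]⟩

@[ext]
lemma hom_ext {M N : DGMod R} {f g : M ⟶ N} (h : ∀ x, f.toLin x = g.toLin x) : f = g :=
  Hom.ext (LinearMap.ext h)

@[simp] lemma id_toLin (M : DGMod R) : Hom.toLin (𝟙 M) = LinearMap.id := rfl

@[simp] lemma comp_toLin {M N P : DGMod R} (f : M ⟶ N) (g : N ⟶ P) :
    (f ≫ g).toLin = g.toLin ∘ₗ f.toLin := rfl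

instance : HasZeroMorphisms (DGMod R) where
  zero M N := ⟨⟨0, fun _ => (N.gr _).zero_mem, fun _ => by simp⟩⟩
  comp_zero _ _ := rfl
  zero_comp _ _ _ f := by
    apply hom_ext
    intro x
    exact f.toLin.map_zero

/-- The underlying `R⁰`-module of a dg module, forgetting the grading and the differential. -/
def toZeroModule (M : DGMod R) : ModuleCat.{u} (R.Zero)ᵐᵒᵖ :=
  (ModuleCat.restrictScalars (RingHom.op R.zeroIncl)).obj (ModuleCat.of (R.carrier)ᵐᵒᵖ M.carrier)

/-! ### Shifts -/

lemma isInternal_reindex {A : Type u} [AddCommGroup A] (gr : ℤ → AddSubgroup A)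
    (h : DirectSum.IsInternal gr) (s : ℤ ≃ ℤ) : DirectSum.IsInternal fun i => gr (s.symm i) := by
  have key : (DirectSum.coeAddMonoidHom fun i => gr (s.symm i)) =
      (DirectSum.coeAddMonoidHom gr).comp
        (DirectSum.equivCongrLeft (β := fun i => gr i) s).symm.toAddMonoidHom := by
    refine DirectSum.addHom_ext fun i y => ?_
    have h1 := DirectSum.equivCongrLeft_of (β := fun i => gr i) s i y
    have h2 : (DirectSum.equivCongrLeft (β := fun i => gr i) s).symm
        (DirectSum.of (fun k => gr (s.symm k)) i y) = DirectSum.of (fun i => gr i) (s.symm i) y := by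
      rw [AddEquiv.symm_apply_eq, h1]
    refine (DirectSum.coeAddMonoidHom_of (fun k => gr (s.symm k)) i y).trans ?_
    refine Eq.trans ?_ (congrArg (DirectSum.coeAddMonoidHom gr) h2).symm
    exact (DirectSum.coeAddMonoidHom_of gr (s.symm i) y).symm
  unfold DirectSum.IsInternal
  rw [key]
  exact h.comp (AddEquiv.bijective _)

/-- The shift `M[n]`: `M[n]ⁱ = Mⁱ⁺ⁿ`, with differential `(-1)ⁿ d` and the same right action. -/
@[simps carrier gr d]
def shiftObj (n : ℤ) (M : DGMod R) : DGMod R where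
  carrier := M.carrier
  gr i := M.gr (i + n)
  isInternal := isInternal_reindex M.gr M.isInternal (Equiv.subRight n)
  smul_mem {i j x a} hx ha := by
    have := M.smul_mem hx ha
    rwa [add_right_comm] at this
  d := (n.negOnePow : ℤ) • M.d
  d_mem {i x} hx := by
    have := M.d_mem hx
    rw [add_right_comm] at this
    exact AddSubgroup.zsmul_mem _ this _
  d_d x := by simp [M.d_d]
  leibniz {i x} hx a := by
    have := M.leibniz hx a
    simp only [AddMonoidHom.smul_apply]
    rw [this, smul_add, smul_comm (op a) (n.negOnePow : ℤ), smul_smul, Int.negOnePow_add,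
      mul_comm i.negOnePow, Units.val_mul, ← mul_assoc, ← Units.val_mul, Int.units_mul_self,
      Units.val_one, one_mul]

/-- The shift functor `M ↦ M[n]`. -/
def shiftFun (n : ℤ) : DGMod R ⥤ DGMod R where
  obj M := shiftObj n M
  map {M N} f := ⟨f.toLin, fun h => f.map_mem h, fun x =>
    (map_zsmul f.toLin _ _).trans (congrArg _ (f.map_d x))⟩

/-- A linear equivalence compatible with the gradings and the differentials is an isomorphism. -/
@[simps]
def isoOfId {M N : DGMod R} (e : M.carrier ≃ₗ[(R.carrier)ᵐᵒᵖ] N.carrier)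
    (h : ∀ i x, x ∈ M.gr i ↔ e x ∈ N.gr i) (hd : ∀ x, e (M.d x) = N.d (e x)) : M ≅ N where
  hom := ⟨e, fun {i x} hx => (h i x).1 hx, hd⟩
  inv := ⟨e.symm, fun {i x} hx => (h i _).2 (by simpa using hx), fun x => by
    apply e.injective
    simp [hd]⟩
  hom_inv_id := by ext x; exact e.symm_apply_apply x
  inv_hom_id := by ext x; exact e.apply_symm_apply x

/-- `M[0] ≅ M`. -/
def shiftZero (M : DGMod R) : shiftObj 0 M ≅ M :=
  isoOfId (M := shiftObj 0 M) (N := M) (LinearEquiv.refl _ M.carrier)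
    (fun i x => by
      change x ∈ M.gr (i + 0) ↔ x ∈ M.gr i
      rw [add_zero])
    (fun x => by
      change ((0 : ℤ).negOnePow : ℤ) • M.d x = M.d x
      simp)

/-- `M[n + m] ≅ M[n][m]`. -/
def shiftAdd (n m : ℤ) (M : DGMod R) : shiftObj (n + m) M ≅ shiftObj m (shiftObj n M) :=
  isoOfId (M := shiftObj (n + m) M) (N := shiftObj m (shiftObj n M)) (LinearEquiv.refl _ M.carrier)
    (fun i x => by
      change x ∈ M.gr (i + (n + m)) ↔ x ∈ M.gr (i + m + n)
      rw [add_assoc, add_comm m n])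
    (fun x => by
      change ((n + m).negOnePow : ℤ) • M.d x = (m.negOnePow : ℤ) • (n.negOnePow : ℤ) • M.d x
      rw [smul_smul, Int.negOnePow_add, mul_comm, Units.val_mul])

lemma eqToHom_shift_toLin {n m : ℤ} (h : n = m) (M : DGMod R)
    (h' : shiftObj n M = shiftObj m M) (x : M.carrier) :
    Hom.toLin (eqToHom h') x = x := by
  subst h
  rfl

/-- The action of `ℤ` on the category of dg modules by the shifts. -/
instance : HasShift (DGMod R) ℤ := hasShiftMk _ _
  { F := shiftFun
    zero := NatIso.ofComponents shiftZero
    add := fun n m => NatIso.ofComponents (shiftAdd n m)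
    assoc_hom_app := fun a b c M => by
      ext x
      exact (eqToHom_shift_toLin (add_assoc a b c) M _ x).symm
    zero_add_hom_app := fun n M => by
      ext x
      exact (eqToHom_shift_toLin (zero_add n) M _ x).symm
    add_zero_hom_app := fun n M => by
      ext x
      exact (eqToHom_shift_toLin (add_zero n) M _ x).symm }

lemma shift_obj_eq (n : ℤ) (M : DGMod R) : M⟦n⟧ = shiftObj n M := rfl

/-! ### The dg module `D(M)` -/

end DGMod

namespace DGRing

variable {R : DGRing.{u}}

/-- The degree-zero component, as an element of `R⁰`. -/
def comp0 (R : DGRing.{u}) : R.carrier →+ R.Zero where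
  toFun a := DirectSum.decompose R.gr a 0
  map_zero' := by simp
  map_add' := by simp

/-- The differential of the component of degree `-1`, as an element of `R⁰`. -/
def dComp (R : DGRing.{u}) : R.carrier →+ R.Zero where
  toFun a := ⟨R.d (R.comp (-1) a),
    R.d_mem (i := -1) (SetLike.coe_mem (DirectSum.decompose R.gr a (-1)))⟩
  map_zero' := by simp
  map_add' a b := by
    ext
    simp

lemma comp_of_mem {i : ℤ} {a : R.carrier} (h : a ∈ R.gr i) : R.comp i a = a :=
  DirectSum.decompose_of_mem_same R.gr h

lemma comp_of_mem_ne {i j : ℤ} {a : R.carrier} (h : a ∈ R.gr i) (hij : i ≠ j) :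
    R.comp j a = 0 :=
  DirectSum.decompose_of_mem_ne R.gr h hij

lemma coe_comp0 (a : R.carrier) : (R.comp0 a : R.carrier) = R.comp 0 a := rfl

lemma coe_dComp (a : R.carrier) : (R.dComp a : R.carrier) = R.d (R.comp (-1) a) := rfl

lemma comp0_of_mem_ne {i : ℤ} {a : R.carrier} (h : a ∈ R.gr i) (hi : i ≠ 0) : R.comp0 a = 0 :=
  Subtype.ext (comp_of_mem_ne h hi)

lemma dComp_of_mem_ne {i : ℤ} {a : R.carrier} (h : a ∈ R.gr i) (hi : i ≠ -1) : R.dComp a = 0 := by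
  apply Subtype.ext
  rw [coe_dComp, comp_of_mem_ne h hi, map_zero]
  rfl

lemma comp0_one : R.comp0 1 = 1 := Subtype.ext (comp_of_mem (SetLike.GradedOne.one_mem))

lemma dComp_one : R.dComp 1 = 0 :=
  dComp_of_mem_ne (i := 0) (SetLike.GradedOne.one_mem) (by decide)

lemma homogeneous_induction {p : R.carrier → Prop} (h0 : p 0)
    (hadd : ∀ a b, p a → p b → p (a + b)) (hh : ∀ i, ∀ a ∈ R.gr i, p a) (a : R.carrier) : p a :=
  DirectSum.Decomposition.inductionOn R.gr h0 (fun {i} m => hh i m m.2) hadd a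

lemma eq_zero_of_pos (hR : R.IsNonpositive) {i : ℤ} (hi : 0 < i) {a : R.carrier}
    (ha : a ∈ R.gr i) : a = 0 := by
  rw [hR i hi] at ha
  exact ha

lemma comp0_mul (hR : R.IsNonpositive) (a b : R.carrier) :
    R.comp0 (a * b) = R.comp0 a * R.comp0 b := by
  induction a using homogeneous_induction with
  | h0 => simp
  | hadd a a' h h' => rw [add_mul, map_add, h, h', map_add, add_mul]
  | hh i a ha =>
    induction b using homogeneous_induction with
    | h0 => simp
    | hadd b b' h h' => rw [mul_add, map_add, h, h', map_add, mul_add]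
    | hh j b hb =>
      have hab : a * b ∈ R.gr (i + j) := SetLike.GradedMul.mul_mem ha hb
      rcases lt_or_ge 0 i with hi | hi
      · simp [eq_zero_of_pos hR hi ha]
      rcases lt_or_ge 0 j with hj | hj
      · simp [eq_zero_of_pos hR hj hb]
      by_cases hij : i = 0 ∧ j = 0
      · obtain ⟨rfl, rfl⟩ := hij
        apply Subtype.ext
        change R.comp 0 (a * b) = R.comp 0 a * R.comp 0 b
        rw [comp_of_mem ha, comp_of_mem hb, comp_of_mem (by simpa using hab)]
      · rw [comp0_of_mem_ne hab (by omega)]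
        by_cases h : i = 0
        · rw [comp0_of_mem_ne hb (by omega)]
          exact (mul_zero _).symm
        · rw [comp0_of_mem_ne ha h]
          exact (zero_mul _).symm

lemma dComp_mul (hR : R.IsNonpositive) (a b : R.carrier) :
    R.dComp (a * b) = R.comp0 a * R.dComp b + R.dComp a * R.comp0 b := by
  induction a using homogeneous_induction with
  | h0 => simp
  | hadd a a' h h' => rw [add_mul, map_add, h, h', map_add, map_add, add_mul, add_mul]; abel
  | hh i a ha =>
    induction b using homogeneous_induction with
    | h0 => simp
    | hadd b b' h h' => rw [mul_add, map_add, h, h', map_add, map_add, mul_add, mul_add]; abel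
    | hh j b hb =>
      have hab : a * b ∈ R.gr (i + j) := SetLike.GradedMul.mul_mem ha hb
      rcases lt_or_ge 0 i with hi | hi
      · simp [eq_zero_of_pos hR hi ha]
      rcases lt_or_ge 0 j with hj | hj
      · simp [eq_zero_of_pos hR hj hb]
      apply Subtype.ext
      change R.d (R.comp (-1) (a * b)) =
        R.comp 0 a * R.d (R.comp (-1) b) + R.d (R.comp (-1) a) * R.comp 0 b
      by_cases hi0 : i = 0
      · subst hi0
        have hda : R.d a = 0 := eq_zero_of_pos hR (by norm_num) (R.d_mem ha)
        rw [comp_of_mem ha, comp_of_mem_ne ha (by decide), map_zero, zero_mul, add_zero]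
        by_cases hj1 : j = -1
        · subst hj1
          rw [comp_of_mem hb, comp_of_mem (by simpa using hab), R.leibniz ha, hda]
          simp
        · rw [comp_of_mem_ne hb hj1, comp_of_mem_ne hab (by omega)]
          simp
      · rw [comp_of_mem_ne ha hi0, zero_mul, zero_add]
        by_cases hi1 : i = -1
        · subst hi1
          rw [comp_of_mem ha]
          by_cases hj0 : j = 0
          · subst hj0
            have hdb : R.d b = 0 := eq_zero_of_pos hR (by norm_num) (R.d_mem hb)
            rw [comp_of_mem hb, comp_of_mem (by simpa using hab), R.leibniz ha, hdb]
            simp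
          · rw [comp_of_mem_ne hb hj0, comp_of_mem_ne hab (by omega)]
            simp
        · rw [comp_of_mem_ne ha hi1, comp_of_mem_ne hab (by omega)]
          simp

lemma comp_d {i k : ℤ} (hk : k = i + 1) (a : R.carrier) :
    R.comp k (R.d a) = R.d (R.comp i a) := by
  subst hk
  induction a using homogeneous_induction with
  | h0 => simp
  | hadd a a' h h' => simp only [map_add, h, h']
  | hh j a ha =>
    by_cases hij : j = i
    · subst hij
      rw [comp_of_mem ha, comp_of_mem (R.d_mem ha)]
    · rw [comp_of_mem_ne ha hij, comp_of_mem_ne (R.d_mem ha) (by omega), map_zero]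

lemma comp0_d (a : R.carrier) : R.comp0 (R.d a) = R.dComp a :=
  Subtype.ext (comp_d (by norm_num) a)

lemma dComp_d (a : R.carrier) : R.dComp (R.d a) = 0 := by
  apply Subtype.ext
  have h : R.comp (-1) (R.d a) = R.d (R.comp (-2) a) := comp_d (by norm_num) a
  rw [coe_dComp, h, R.d_d]
  rfl

end DGRing

namespace DGMod

variable {R : DGRing.{u}}

/-- The right action of `R` on `D(M)`. The pair `(x, y)` stands for `x` in degree `-1` plus
`y` in degree `0`, and `(x, y) · a = (x a₀ + y d(a₋₁), y a₀)`. -/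
def dAct (M : ModuleCat.{u} (R.Zero)ᵐᵒᵖ) (a : R.carrier) (p : M × M) : M × M :=
  (op (R.comp0 a) • p.1 + op (R.dComp a) • p.2, op (R.comp0 a) • p.2)

lemma dAct_zero (M : ModuleCat.{u} (R.Zero)ᵐᵒᵖ) (p : M × M) : dAct M 0 p = 0 := by
  have h1 : ∀ x : M, op (R.comp0 0) • x = 0 := fun x => by
    rw [map_zero]; exact zero_smul (R.Zero)ᵐᵒᵖ x
  have h2 : ∀ x : M, op (R.dComp 0) • x = 0 := fun x => by
    rw [map_zero]; exact zero_smul (R.Zero)ᵐᵒᵖ x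
  simp only [dAct, h1, h2, add_zero]
  rfl

/-- The right `R`-module structure of `D(M)`. -/
abbrev dModule (hR : R.IsNonpositive) (M : ModuleCat.{u} (R.Zero)ᵐᵒᵖ) :
    Module (R.carrier)ᵐᵒᵖ (M × M) where
  smul a p := dAct M a.unop p
  one_smul p := by
    change dAct M 1 p = p
    have h1 : ∀ x : M, op (R.comp0 1) • x = x := fun x => by
      rw [DGRing.comp0_one]; exact one_smul _ x
    have h2 : ∀ x : M, op (R.dComp 1) • x = 0 := fun x => by
      rw [DGRing.dComp_one]; exact zero_smul (R.Zero)ᵐᵒᵖ x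
    simp only [dAct, h1, h2, add_zero]
  mul_smul a b p := by
    change dAct M (b.unop * a.unop) p = dAct M a.unop (dAct M b.unop p)
    simp only [dAct, DGRing.comp0_mul hR, DGRing.dComp_mul hR, op_mul, MulOpposite.op_add, mul_smul, add_smul,
      smul_add]
    rw [add_assoc]
    congr 2
    abel
  smul_zero a := by
    change dAct M a.unop 0 = 0
    simp [dAct]
  smul_add a p q := by
    change dAct M a.unop (p + q) = dAct M a.unop p + dAct M a.unop q
    simp only [dAct, Prod.fst_add, Prod.snd_add, smul_add, Prod.mk_add_mk]
    congr 1
    abel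
  add_smul a b p := by
    change dAct M (a.unop + b.unop) p = dAct M a.unop p + dAct M b.unop p
    simp only [dAct, map_add, MulOpposite.op_add, add_smul, Prod.mk_add_mk]
    congr 1
    abel
  zero_smul p := by
    exact dAct_zero M p

/-- The grading of `D(M)`: the first factor is in degree `-1`, the second in degree `0`. -/
def dGr (A : Type u) [AddCommGroup A] (i : ℤ) : AddSubgroup (A × A) where
  carrier := {p | (i ≠ -1 → p.1 = 0) ∧ (i ≠ 0 → p.2 = 0)}
  zero_mem' := ⟨fun _ => rfl, fun _ => rfl⟩
  add_mem' {p q} hp hq := ⟨fun h => by simp [hp.1 h, hq.1 h], fun h => by simp [hp.2 h, hq.2 h]⟩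
  neg_mem' {p} hp := ⟨fun h => by simp [hp.1 h], fun h => by simp [hp.2 h]⟩

/-- The inclusion of the first factor, in degree `-1`. -/
def dInl (A : Type u) [AddCommGroup A] : A →+ dGr A (-1) where
  toFun x := ⟨(x, 0), by simp [dGr]⟩
  map_zero' := rfl
  map_add' x y := Subtype.ext (by simp)

/-- The inclusion of the second factor, in degree `0`. -/
def dInr (A : Type u) [AddCommGroup A] : A →+ dGr A 0 where
  toFun x := ⟨(0, x), by simp [dGr]⟩
  map_zero' := rfl
  map_add' x y := Subtype.ext (by simp)

/-- The decomposition of `A × A` into its two factors, placed in degrees `-1` and `0`. -/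
abbrev dDecomposition (A : Type u) [AddCommGroup A] : DirectSum.Decomposition (dGr A) :=
  DirectSum.Decomposition.ofAddHom (dGr A)
    (((DirectSum.of (fun i => dGr A i) (-1)).comp (dInl A)).coprod
      ((DirectSum.of (fun i => dGr A i) 0).comp (dInr A)))
    (by
      ext p <;> simp [dInl, dInr])
    (by
      refine DirectSum.addHom_ext fun i y => ?_
      obtain ⟨⟨x, y⟩, hx, hy⟩ := y
      simp only [AddMonoidHom.comp_apply, DirectSum.coeAddMonoidHom_of, AddMonoidHom.id_apply,
        AddMonoidHom.coprod_apply]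
      by_cases h1 : i = -1
      · subst h1
        obtain rfl : y = 0 := hy (by decide)
        rw [map_zero, map_zero, add_zero]
        rfl
      · obtain rfl : x = 0 := hx h1
        rw [map_zero, map_zero, zero_add]
        by_cases h0 : i = 0
        · subst h0
          rfl
        · obtain rfl : y = 0 := hy h0
          rw [map_zero, map_zero]
          exact (map_zero (DirectSum.of (fun i => dGr A i) i)).symm)

lemma dGr_isInternal (A : Type u) [AddCommGroup A] : DirectSum.IsInternal (dGr A) :=
  letI := dDecomposition A
  DirectSum.Decomposition.isInternal (dGr A)

/-- For a non-positive dg ring `R` and an `R⁰`-module `M`, the dg module `D(M)`: the complex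
`M → M` (the identity map) concentrated in degrees `-1` and `0`, on which `a ∈ Rⁱ` acts on
`x ∈ D(M)ʲ` by `x a` if `i = 0`, by `x d(a)` if `i = -1` and `j = 0`, and by zero otherwise. -/
def D (hR : R.IsNonpositive) (M : ModuleCat.{u} (R.Zero)ᵐᵒᵖ) : DGMod R where
  carrier := M × M
  module := dModule hR M
  gr := dGr M
  isInternal := dGr_isInternal M
  smul_mem {i j p a} hp ha := by
    change dAct M a p ∈ dGr M (i + j)
    rcases lt_or_ge 0 j with hj | hj
    · rw [DGRing.eq_zero_of_pos hR hj ha, dAct_zero]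
      exact zero_mem _
    · refine ⟨fun h => ?_, fun h => ?_⟩
      · change op (R.comp0 a) • p.1 + op (R.dComp a) • p.2 = 0
        have h1 : op (R.comp0 a) • p.1 = 0 := by
          by_cases hj0 : j = 0
          · rw [hp.1 (by omega), smul_zero]
          · rw [DGRing.comp0_of_mem_ne ha hj0]
            exact zero_smul (R.Zero)ᵐᵒᵖ p.1
        have h2 : op (R.dComp a) • p.2 = 0 := by
          by_cases hj1 : j = -1
          · rw [hp.2 (by omega), smul_zero]
          · rw [DGRing.dComp_of_mem_ne ha hj1]
            exact zero_smul (R.Zero)ᵐᵒᵖ p.2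
        rw [h1, h2, add_zero]
      · change op (R.comp0 a) • p.2 = 0
        by_cases hj0 : j = 0
        · rw [hp.2 (by omega), smul_zero]
        · rw [DGRing.comp0_of_mem_ne ha hj0]
          exact zero_smul (R.Zero)ᵐᵒᵖ p.2
  d := 
    { toFun := fun p => (0, p.1)
      map_zero' := rfl
      map_add' := fun p q => by simp }
  d_mem {i p} hp := ⟨fun _ => rfl, fun h => hp.1 (by omega)⟩
  d_d p := rfl
  leibniz {i p} hp a := by
    change ((0, op (R.comp0 a) • p.1 + op (R.dComp a) • p.2) : M × M) =
      dAct M a (0, p.1) + (i.negOnePow : ℤ) • dAct M (R.d a) p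
    have h0 : R.dComp (R.d a) = 0 := DGRing.dComp_d a
    have h1 : R.comp0 (R.d a) = R.dComp a := DGRing.comp0_d a
    have h2 : op (R.dComp (R.d a)) • p.2 = 0 := by
      rw [h0]
      exact zero_smul (R.Zero)ᵐᵒᵖ p.2
    simp only [dAct, h1, h2, add_zero, smul_zero, zero_add]
    by_cases hi : i = -1
    · subst hi
      have hp2 : p.2 = 0 := hp.2 (by decide)
      simp [hp2]
    · have hp1 : p.1 = 0 := hp.1 hi
      by_cases hi0 : i = 0
      · subst hi0
        simp [hp1]
      · have hp2 : p.2 = 0 := hp.2 hi0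
        simp [hp1, hp2]

end DGMod

end

/-! Everything is governed by the primes of `R⁰`. This ring is central in `R` by skew-commutativity,
and it is noetherian because an ideal of `R⁰` is recovered from the dg ideal it generates. The task
is to attach primes to dg modules and to show that the prime of a monoform object determines its
atom up to shift.

The link is the socle element: a homogeneous `x` killed by `R^{<0}` and with annihilator `p` in
`R⁰`. The Leibniz rule expresses the action of `R` on `dx` through `R⁰` and `d(R⁻¹)`, so all
relations between `x` and `dx` depend only on the degree, on `p` and on `Ann(dx)`
(`IsSocleElement.relation_iff`). Socle elements with equal data generate isomorphic dg submodules.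
Every associated prime of the underlying `R⁰`-module is carried by a socle element with `dx = 0` or
`Ann(dx) = p` (`exists_isSocleElement`): boundedness gives a lowest degree to work in, and the dg
noetherian condition gives one multiplier outside `p` that serves all of `R^{<0}`. Both types occur
in shifts of `D(H)` when `p` is the annihilator of an element of `H`: `(x, 0)` has a differential
with annihilator `p`, and `(0, x)` is a cycle, which is a socle element as soon as `d(R⁻¹) ⊆ p`.
Hence a dg module with associated prime `p` shares a nonzero subobject with some `D(H)[n]`
(`exists_haveCommon_shiftD`).

Monoform dg modules are uniform, so they have exactly one associated prime (`hasAnn_unique`). It is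
invariant under shift and atom-equivalence, which makes the map induced by `D` injective;
surjectivity and the formula for `Ass` follow from the previous paragraph.

For condition `(*)`, lift an element with annihilator `q` from a subquotient to `M`. The
localization argument gives an associated prime `p ≤ q` of `M`. The atom of `D(R⁰/q)` specializes to
that of `D(R⁰/p)`, because a subquotient of type `p` has a quotient containing an object of type
`q`: divide by `q·w + q·dw` for a socle element `w` (`mem_atomSupp_of_le`). -/

noncomputable section

/-! ### Annihilators of elements -/

section Annihilators

variable {A : Type u} [Ring A] {M N : Type*} [AddCommGroup M] [Module A M] [AddCommGroup N]
  [Module A N]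

/-- The annihilator of the element `x` is the ideal `p`. -/
def HasAnn (p : Ideal A) (x : M) : Prop := ∀ r : A, r • x = 0 ↔ r ∈ p

lemma HasAnn.ne_zero {p : Ideal A} [hp : p.IsPrime] {x : M} (h : HasAnn p x) : x ≠ 0 := by
  rintro rfl
  exact hp.ne_top ((Ideal.eq_top_iff_one p).2 ((h 1).1 (smul_zero _)))

lemma HasAnn.eq {p q : Ideal A} {x : M} (hp : HasAnn p x) (hq : HasAnn q x) : p = q := by
  ext r
  rw [← hp r, hq r]

lemma HasAnn.map {p : Ideal A} {x : M} (h : HasAnn p x) (f : M →ₗ[A] N)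
    (hf : Function.Injective f) : HasAnn p (f x) := fun r => by
  rw [← map_smul, map_eq_zero_iff f hf, h r]

variable (hA : ∀ a b : A, a * b = b * a)
include hA

lemma smul_smul_comm_of_comm (a b : A) (x : M) : a • b • x = b • a • x := by
  rw [smul_smul, hA, mul_smul]

lemma HasAnn.smul {p : Ideal A} [hp : p.IsPrime] {x : M} (h : HasAnn p x) {s : A} (hs : s ∉ p) :
    HasAnn p (s • x) := fun r => by
  rw [smul_smul, h]
  refine ⟨fun hr => (hp.mem_or_mem hr).resolve_right hs, fun hr => ?_⟩
  rw [hA]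
  exact p.mul_mem_left s hr

/-- The usual maximal-annihilator argument, restricted to multiples of `x` that no element of `S`
kills. With `S` the complement of a prime `q`, it produces an associated prime inside `q` without
passing to the localization. -/
lemma exists_hasAnn_smul [IsNoetherianRing A] (S : Submonoid A) (x : M)
    (hx : ∀ s ∈ S, s • x ≠ 0) :
    ∃ p : Ideal A, p.IsPrime ∧ (∀ s ∈ S, s ∉ p) ∧ ∃ r : A, HasAnn p (r • x) := by
  let T : Set (Ideal A) := {I | ∃ r : A, (∀ s ∈ S, s • r • x ≠ 0) ∧ I = Ideal.torsionOf A M (r • x)}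
  have hT : T.Nonempty := ⟨_, 1, by simpa using hx, rfl⟩
  obtain ⟨p, ⟨r, hr, rfl⟩, hmax⟩ := set_has_maximal_iff_noetherian.2 (inferInstance) T hT
  have key : ∀ b : A, (∀ s ∈ S, s • b • r • x ≠ 0) → ∀ a : A, a • b • r • x = 0 → a • r • x = 0 := by
    intro b hb a ha
    have hle : Ideal.torsionOf A M (r • x) ≤ Ideal.torsionOf A M ((b * r) • x) := by
      intro c hc
      rw [Ideal.mem_torsionOf_iff] at hc ⊢
      rw [mul_smul, smul_smul_comm_of_comm hA, hc, smul_zero]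
    have := hmax _ ⟨b * r, by simpa only [mul_smul] using hb, rfl⟩
    have heq := eq_of_le_of_not_lt hle this
    have : a ∈ Ideal.torsionOf A M (r • x) := by
      rw [heq, Ideal.mem_torsionOf_iff, mul_smul]
      exact ha
    exact (Ideal.mem_torsionOf_iff _ _).1 this
  refine ⟨_, ⟨?_, ?_⟩, ?_, r, fun _ => (Ideal.mem_torsionOf_iff _ _).symm⟩
  · rw [Ideal.ne_top_iff_one, Ideal.mem_torsionOf_iff]
    exact hr 1 S.one_mem
  · intro a b hab
    simp only [Ideal.mem_torsionOf_iff] at hab ⊢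
    rw [mul_smul] at hab
    by_cases hb : ∀ s ∈ S, s • b • r • x ≠ 0
    · exact Or.inl (key b hb a hab)
    · push Not at hb
      obtain ⟨s, hs, hsb⟩ := hb
      -- Here `s` is an admissible multiplier because `S` is closed under products, and `b` kills `s
      -- • r • x`; so `key` applies with `s` in the role of `b`.
      refine Or.inr (key s (fun t ht h => hr (t * s) (S.mul_mem ht hs) (by rwa [mul_smul])) b ?_)
      rwa [smul_smul_comm_of_comm hA]
  · intro s hs h
    exact hr s hs ((Ideal.mem_torsionOf_iff _ _).1 h)

lemma exists_hasAnn_of_ne_zero [IsNoetherianRing A] {x : M} (hx : x ≠ 0) :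
    ∃ p : Ideal A, p.IsPrime ∧ ∃ r : A, HasAnn p (r • x) := by
  obtain ⟨p, hp, -, h⟩ := exists_hasAnn_smul hA (⊥ : Submonoid A) x (by
    intro s hs
    rw [Submonoid.mem_bot.1 hs, one_smul]
    exact hx)
  exact ⟨p, hp, h⟩

lemma exists_notMem_smul_eq_zero {p : Ideal A} [hp : p.IsPrime] {ι : Type*} (s : Finset ι)
    (x : ι → M) (h : ∀ i ∈ s, ∃ r ∉ p, r • x i = 0) : ∃ r ∉ p, ∀ i ∈ s, r • x i = 0 := by
  classical
  induction s using Finset.induction_on with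
  | empty => exact ⟨1, p.one_notMem, by simp⟩
  | insert i s _ ih =>
    obtain ⟨r, hr, hrs⟩ := ih fun j hj => h j (Finset.mem_insert_of_mem hj)
    obtain ⟨t, ht, hti⟩ := h i (Finset.mem_insert_self i s)
    refine ⟨r * t, fun hrt => (hp.mem_or_mem hrt).elim hr ht, fun j hj => ?_⟩
    rcases Finset.mem_insert.1 hj with rfl | hj
    · rw [mul_smul, hti, smul_zero]
    · rw [mul_smul, smul_smul_comm_of_comm hA, hrs j hj, smul_zero]

/-- If no summand had annihilator exactly `p`, each would be killed by an element outside `p`; the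
product of these lies outside `p` and kills the sum. -/
lemma HasAnn.exists_of_sum {p : Ideal A} [hp : p.IsPrime] {ι : Type*} (s : Finset ι)
    (x : ι → M) (h : HasAnn p (∑ i ∈ s, x i)) (hx : ∀ i ∈ s, ∀ r ∈ p, r • x i = 0) :
    ∃ i ∈ s, HasAnn p (x i) := by
  by_contra! hcon
  obtain ⟨r, hr, hrs⟩ := exists_notMem_smul_eq_zero hA (p := p) s x (by
    intro i hi
    by_contra! hri
    exact hcon i hi fun r => ⟨fun h0 => by_contra fun hr => hri r hr h0, hx i hi r⟩)
  exact hr ((h r).1 (by rw [Finset.smul_sum]; exact Finset.sum_eq_zero hrs))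

end Annihilators

lemma HaveCommonNonzeroSubobject.of_mono {C : Type u} [Category.{v} C] {X Y X' Y' : C}
    (h : HaveCommonNonzeroSubobject X Y) (i : X ⟶ X') [Mono i] (j : Y ⟶ Y') [Mono j] :
    HaveCommonNonzeroSubobject X' Y' := by
  obtain ⟨Z, hZ, ⟨f, _⟩, ⟨g, _⟩⟩ := h
  exact ⟨Z, hZ, ⟨f ≫ i, mono_comp _ _⟩, ⟨g ≫ j, mono_comp _ _⟩⟩

/-! ### Monoform modules -/

namespace ModuleCat

variable {A : Type u} [Ring A]

/-- Both cyclic submodules are copies of `A / Ann(x)`. -/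
lemma haveCommon_of_ann {X Y : ModuleCat.{u} A} {x : X} {y : Y} (hx : x ≠ 0)
    (h : ∀ r : A, r • x = 0 ↔ r • y = 0) : HaveCommonNonzeroSubobject X Y := by
  let K := LinearMap.ker (LinearMap.toSpanSingleton A X x)
  let f : (A ⧸ K) →ₗ[A] X := K.liftQ (LinearMap.toSpanSingleton A X x) le_rfl
  have hK : K = LinearMap.ker (LinearMap.toSpanSingleton A Y y) := by
    ext r
    simpa [K] using h r
  let g : (A ⧸ K) →ₗ[A] Y := K.liftQ (LinearMap.toSpanSingleton A Y y) hK.le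
  refine ⟨ModuleCat.of A (A ⧸ K), ?_, ⟨ModuleCat.ofHom f, ?_⟩, ⟨ModuleCat.ofHom g, ?_⟩⟩
  · intro hz
    have := ModuleCat.subsingleton_of_isZero hz
    have h1 : f (K.mkQ 1) = f 0 := congrArg f (Subsingleton.elim (α := A ⧸ K) _ _)
    simp [f] at h1
    exact hx h1
  · rw [ModuleCat.mono_iff_injective]
    exact LinearMap.ker_eq_bot.1 (Submodule.ker_liftQ_eq_bot _ _ _ le_rfl)
  · rw [ModuleCat.mono_iff_injective]
    exact LinearMap.ker_eq_bot.1 (Submodule.ker_liftQ_eq_bot _ _ _ hK.ge)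

lemma exists_ne_zero_of_haveCommon {X Y : ModuleCat.{u} A} (h : HaveCommonNonzeroSubobject X Y) :
    ∃ (Z : ModuleCat.{u} A) (f : Z →ₗ[A] X) (g : Z →ₗ[A] Y) (z : Z),
      Function.Injective f ∧ Function.Injective g ∧ z ≠ 0 := by
  obtain ⟨Z, hZ, ⟨f, hf⟩, ⟨g, hg⟩⟩ := h
  rw [ModuleCat.mono_iff_injective] at hf hg
  have : Nontrivial Z := by
    rw [← not_subsingleton_iff_nontrivial]
    intro _
    exact hZ (ModuleCat.isZero_of_subsingleton Z)
  obtain ⟨z, hz⟩ := exists_ne (0 : Z)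
  exact ⟨Z, f.hom, g.hom, z, hf, hg, hz⟩

lemma exists_ne_zero_of_not_isZero {X : ModuleCat.{u} A} (h : ¬ IsZero X) : ∃ x : X, x ≠ 0 := by
  by_contra! hX
  have : Subsingleton X := ⟨fun a b => by rw [hX a, hX b]⟩
  exact h (ModuleCat.isZero_of_subsingleton X)

lemma not_isZero_of_ne_zero {X : ModuleCat.{u} A} {x : X} (h : x ≠ 0) : ¬ IsZero X := fun hX =>
  have := ModuleCat.subsingleton_of_isZero hX
  h (Subsingleton.elim _ _)

/-- A common nonzero subobject of `H` and `H/L` may be taken cyclic, so it amounts to an equality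
`Ann(x) = (L : y)` with `x ≠ 0`. Together with `isMonoform_of_not_ann` this gives an elementwise
criterion. -/
lemma not_ann_of_isMonoform {H : ModuleCat.{u} A} (hH : IsMonoform H) {L : Submodule A H}
    (hL : L ≠ ⊥) {x : H} (hx : x ≠ 0) (y : H) : ¬ ∀ r : A, r • x = 0 ↔ r • y ∈ L := by
  intro h
  obtain ⟨l, hl, hl0⟩ := Submodule.exists_mem_ne_zero_of_ne_bot hL
  have hLz : ¬ IsZero (ModuleCat.of A L) :=
    not_isZero_of_ne_zero (X := ModuleCat.of A L) (x := (⟨l, hl⟩ : L)) fun h0 =>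
      hl0 (congrArg Subtype.val h0)
  refine hH.2 (ModuleCat.of A L) (ModuleCat.ofHom L.subtype) ?_ hLz
    (ModuleCat.of A (H ⧸ L)) (ModuleCat.ofHom L.mkQ) ?_ ⟨?_⟩ ?_
  · rw [ModuleCat.mono_iff_injective]
    exact L.injective_subtype
  · ext z
    simp
  · exact ModuleCat.isColimitCokernelCofork (ModuleCat.ofHom L.subtype) (ModuleCat.ofHom L.mkQ)
      (LinearMap.exact_subtype_mkQ L) L.mkQ_surjective
  · refine haveCommon_of_ann (X := H) (Y := ModuleCat.of A (H ⧸ L)) (x := x) (y := L.mkQ y) hx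
      fun r => ?_
    rw [h r, ← map_smul, Submodule.mkQ_apply, Submodule.Quotient.mk_eq_zero]

lemma isMonoform_of_not_ann {H : ModuleCat.{u} A} {x₀ : H} (hx₀ : x₀ ≠ 0)
    (h : ∀ L : Submodule A H, L ≠ ⊥ → ∀ x : H, x ≠ 0 → ∀ y : H, ¬ ∀ r : A, r • x = 0 ↔ r • y ∈ L) :
    IsMonoform H := by
  refine ⟨not_isZero_of_ne_zero hx₀, fun L i hi hL Q p w ⟨hp⟩ hc => ?_⟩
  let e : Q ≅ ModuleCat.of A (H ⧸ LinearMap.range i.hom) :=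
    hp.coconePointUniqueUpToIso (ModuleCat.cokernelIsColimit i)
  have hc' : HaveCommonNonzeroSubobject H (ModuleCat.of A (H ⧸ LinearMap.range i.hom)) :=
    hc.of_mono (𝟙 H) e.hom
  obtain ⟨Z, f, g, z, hf, hg, hz⟩ := exists_ne_zero_of_haveCommon hc'
  obtain ⟨y, hy⟩ := (LinearMap.range i.hom).mkQ_surjective (g z)
  rw [ModuleCat.mono_iff_injective] at hi
  refine h (LinearMap.range i.hom) ?_ (f z) ((map_ne_zero_iff f hf).2 hz) y fun r => ?_
  · obtain ⟨l, hl⟩ := exists_ne_zero_of_not_isZero hL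
    intro hbot
    have : i.hom l ∈ LinearMap.range i.hom := ⟨l, rfl⟩
    rw [hbot, Submodule.mem_bot] at this
    exact hl (hi (this.trans (map_zero i.hom).symm))
  · rw [← map_smul, map_eq_zero_iff f hf, ← map_eq_zero_iff g hg, map_smul, ← hy, ← map_smul,
      Submodule.mkQ_apply, Submodule.Quotient.mk_eq_zero]

variable (hA : ∀ a b : A, a * b = b * a)
include hA

lemma hasAnn_mk {p : Ideal A} {s : A} [hp : p.IsPrime] (hs : s ∉ p) :
    HasAnn p (Submodule.Quotient.mk s : A ⧸ p) := fun r => by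
  rw [← Submodule.Quotient.mk_smul, Submodule.Quotient.mk_eq_zero, smul_eq_mul]
  refine ⟨fun h => (hp.mem_or_mem h).resolve_right hs, fun h => ?_⟩
  rw [hA]
  exact p.mul_mem_left s h

lemma hasAnn_of_quotient {p : Ideal A} [p.IsPrime] {x : A ⧸ p} (hx : x ≠ 0) : HasAnn p x := by
  obtain ⟨s, rfl⟩ := Submodule.Quotient.mk_surjective _ x
  exact hasAnn_mk hA fun hs => hx ((Submodule.Quotient.mk_eq_zero _).2 hs)

lemma isMonoform_quotient (p : Ideal A) [hp : p.IsPrime] : IsMonoform (ModuleCat.of A (A ⧸ p)) := by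
  refine isMonoform_of_not_ann (H := ModuleCat.of A (A ⧸ p))
    (x₀ := (Submodule.Quotient.mk 1 : A ⧸ p)) (hasAnn_mk hA p.one_notMem).ne_zero ?_
  intro L hL x hx y h
  have hxp : HasAnn p (M := A ⧸ p) x := hasAnn_of_quotient hA hx
  obtain ⟨l, hl, hl0⟩ := Submodule.exists_mem_ne_zero_of_ne_bot hL
  obtain ⟨s, rfl⟩ := Submodule.Quotient.mk_surjective _ (l : A ⧸ p)
  obtain ⟨t, rfl⟩ := Submodule.Quotient.mk_surjective _ (y : A ⧸ p)
  refine hl0 ((Submodule.Quotient.mk_eq_zero _).2 ((hxp s).1 ((h s).2 ?_)))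
  -- By commutativity, `s` carries the class of `t` into `L`, which contains the class of `s`. Then
  -- `s` kills `x`, so `s ∈ p`, although its class is nonzero.
  have h1 : s • (Submodule.Quotient.mk t : A ⧸ p) = t • (Submodule.Quotient.mk s : A ⧸ p) := by
    rw [← Submodule.Quotient.mk_smul, ← Submodule.Quotient.mk_smul, smul_eq_mul, smul_eq_mul, hA]
  exact (congrArg (· ∈ L) h1).mpr (L.smul_mem t hl)

end ModuleCat

/-! ### Components of elements of dg modules -/

/-- Meant for dg submodules and quotients, where the component maps of the ambient module restrict
or descend. -/
lemma isInternal_of_projections {A : Type u} [AddCommGroup A] (gr : ℤ → AddSubgroup A)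
    (c : ℤ → A →+ A) (same : ∀ i, ∀ x ∈ gr i, c i x = x)
    (ne : ∀ i j, i ≠ j → ∀ x ∈ gr i, c j x = 0)
    (span : ∀ P : AddSubgroup A, (∀ i, gr i ≤ P) → ∀ x, x ∈ P) : DirectSum.IsInternal gr := by
  classical
  refine ⟨(injective_iff_map_eq_zero _).2 fun f hf => ?_, fun x => ?_⟩
  · ext i
    have h : (c i).comp (DirectSum.coeAddMonoidHom gr) =
        (gr i).subtype.comp (DFinsupp.evalAddMonoidHom i) := by
      refine DirectSum.addHom_ext fun j y => ?_
      by_cases hij : j = i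
      · subst hij
        simp only [AddMonoidHom.comp_apply, DirectSum.coeAddMonoidHom_of]
        rw [same _ _ y.2]
        exact (congrArg Subtype.val (DirectSum.of_eq_same (β := fun i => gr i) j y)).symm
      · simp only [AddMonoidHom.comp_apply, DirectSum.coeAddMonoidHom_of]
        rw [ne _ _ hij _ y.2]
        exact (congrArg Subtype.val
          (DirectSum.of_eq_of_ne (β := fun i => gr i) j i y (Ne.symm hij))).symm
    have h2 := DFunLike.congr_fun h f
    simp only [AddMonoidHom.comp_apply] at h2
    rw [hf, map_zero] at h2
    exact h2.symm
  · exact span (DirectSum.coeAddMonoidHom gr).range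
      (fun i y hy => ⟨DirectSum.of (fun i => gr i) i ⟨y, hy⟩, DirectSum.coeAddMonoidHom_of _ _ _⟩) x

namespace DGMod

variable {R : DGRing.{u}}

instance decomposition (M : DGMod R) : DirectSum.Decomposition M.gr :=
  M.isInternal.chooseDecomposition

/-- The homogeneous component of degree `i`. -/
def comp (M : DGMod R) (i : ℤ) : M.carrier →+ M.carrier where
  toFun x := DirectSum.decompose M.gr x i
  map_zero' := by simp
  map_add' := by simp

lemma comp_mem (M : DGMod R) (i : ℤ) (x : M.carrier) : M.comp i x ∈ M.gr i :=
  SetLike.coe_mem (DirectSum.decompose M.gr x i)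

lemma comp_of_mem {M : DGMod R} {i : ℤ} {x : M.carrier} (h : x ∈ M.gr i) : M.comp i x = x :=
  DirectSum.decompose_of_mem_same M.gr h

lemma comp_of_mem_ne {M : DGMod R} {i j : ℤ} {x : M.carrier} (h : x ∈ M.gr i) (hij : i ≠ j) :
    M.comp j x = 0 :=
  DirectSum.decompose_of_mem_ne M.gr h hij

lemma sum_comp (M : DGMod R) (x : M.carrier) : ∃ s : Finset ℤ, x = ∑ i ∈ s, M.comp i x := by
  classical
  exact ⟨_, (DirectSum.sum_support_decompose M.gr x).symm⟩

lemma homogeneous_induction {M : DGMod R} {p : M.carrier → Prop} (h0 : p 0)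
    (hadd : ∀ a b, p a → p b → p (a + b)) (hh : ∀ i, ∀ a ∈ M.gr i, p a) (a : M.carrier) : p a :=
  DirectSum.Decomposition.inductionOn M.gr h0 (fun {i} m => hh i m m.2) hadd a

lemma comp_d (M : DGMod R) {i j : ℤ} (hij : i + 1 = j) (x : M.carrier) :
    M.comp j (M.d x) = M.d (M.comp i x) := by
  subst hij
  induction x using homogeneous_induction with
  | h0 => simp
  | hadd a b ha hb => simp only [map_add, ha, hb]
  | hh k a ha =>
    by_cases h : k = i
    · subst h
      rw [comp_of_mem ha, comp_of_mem (M.d_mem ha)]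
    · rw [comp_of_mem_ne ha h, comp_of_mem_ne (M.d_mem ha) (by omega), map_zero]

lemma comp_smul_of_mem (M : DGMod R) {i j k : ℤ} (h : i + j = k) (x : M.carrier) {a : R.carrier}
    (ha : a ∈ R.gr j) : M.comp k (op a • x) = op a • M.comp i x := by
  subst h
  induction x using homogeneous_induction with
  | h0 => simp
  | hadd x y hx hy => simp only [smul_add, map_add, hx, hy]
  | hh l x hx =>
    by_cases h : l = i
    · subst h
      rw [comp_of_mem hx, comp_of_mem (M.smul_mem hx ha)]
    · rw [comp_of_mem_ne hx h, comp_of_mem_ne (M.smul_mem hx ha) (by omega), smul_zero]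

lemma comp_mem_smul (M : DGMod R) {i j k : ℤ} (h : i + j = k) {x : M.carrier} (hx : x ∈ M.gr i)
    (a : R.carrier) : M.comp k (op a • x) = op (R.comp j a) • x := by
  subst h
  induction a using DGRing.homogeneous_induction with
  | h0 => simp
  | hadd a b ha hb => simp only [MulOpposite.op_add, add_smul, map_add, ha, hb]
  | hh l a ha =>
    by_cases h : l = j
    · subst h
      rw [DGRing.comp_of_mem ha, comp_of_mem (M.smul_mem hx ha)]
    · rw [DGRing.comp_of_mem_ne ha h, comp_of_mem_ne (M.smul_mem hx ha) (by omega)]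
      simp

lemma comp_map {M N : DGMod R} (f : M ⟶ N) (i : ℤ) (x : M.carrier) :
    N.comp i (f.toLin x) = f.toLin (M.comp i x) := by
  induction x using homogeneous_induction with
  | h0 => simp
  | hadd a b ha hb => simp only [map_add, ha, hb]
  | hh k a ha =>
    by_cases h : k = i
    · subst h
      rw [comp_of_mem ha, comp_of_mem (f.map_mem ha)]
    · rw [comp_of_mem_ne ha h, comp_of_mem_ne (f.map_mem ha) h, map_zero]

lemma mem_gr_of_map {M N : DGMod R} (f : M ⟶ N) (hf : Function.Injective f.toLin) {i : ℤ}
    {x : M.carrier} (h : f.toLin x ∈ N.gr i) : x ∈ M.gr i := by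
  have : M.comp i x = x := hf (by rw [← comp_map, comp_of_mem h])
  rw [← this]
  exact M.comp_mem i x

end DGMod

/-! ### Dg submodules -/

/-- A dg submodule: a graded submodule stable under the differential. -/
structure DGSub {R : DGRing.{u}} (M : DGMod R) where
  toSub : Submodule (R.carrier)ᵐᵒᵖ M.carrier
  comp_mem : ∀ i, ∀ x ∈ toSub, M.comp i x ∈ toSub
  d_mem : ∀ x ∈ toSub, M.d x ∈ toSub

namespace DGSub

variable {R : DGRing.{u}} {M : DGMod R}

/-- A dg submodule as a dg module. -/
def obj (N : DGSub M) : DGMod R where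
  carrier := N.toSub
  gr i := (M.gr i).comap N.toSub.subtype.toAddMonoidHom
  isInternal := by
    refine isInternal_of_projections _
      (fun i => ((M.comp i).comp N.toSub.subtype.toAddMonoidHom).codRestrict N.toSub
        fun x => N.comp_mem i x x.2)
      (fun i x hx => Subtype.ext (DGMod.comp_of_mem hx))
      (fun i j hij x hx => Subtype.ext (DGMod.comp_of_mem_ne hx hij)) fun P hP x => ?_
    obtain ⟨s, hs⟩ := M.sum_comp x
    have : x = ∑ i ∈ s, (⟨M.comp i x, N.comp_mem i x x.2⟩ : N.toSub) := by
      apply Subtype.ext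
      rw [AddSubmonoidClass.coe_finsetSum]
      exact hs
    rw [this]
    exact P.sum_mem fun i _ => hP i (M.comp_mem i x)
  smul_mem hx ha := M.smul_mem hx ha
  d := (M.d.comp N.toSub.subtype.toAddMonoidHom).codRestrict N.toSub fun x => N.d_mem x x.2
  d_mem hx := M.d_mem hx
  d_d x := Subtype.ext (M.d_d x)
  leibniz {i x} hx a := Subtype.ext (M.leibniz (x := x) hx a)

/-- The inclusion of a dg submodule. -/
def incl (N : DGSub M) : N.obj ⟶ M := ⟨N.toSub.subtype, fun h => h, fun _ => rfl⟩

lemma incl_injective (N : DGSub M) : Function.Injective N.incl.toLin := N.toSub.injective_subtype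

/-- The additive endomorphism of the quotient induced by an additive endomorphism. -/
def quotMap (N : DGSub M) (f : M.carrier →+ M.carrier) (hf : ∀ x ∈ N.toSub, f x ∈ N.toSub) :
    (M.carrier ⧸ N.toSub) →+ (M.carrier ⧸ N.toSub) :=
  QuotientAddGroup.map N.toSub.toAddSubgroup N.toSub.toAddSubgroup f hf

lemma quotMap_mk (N : DGSub M) (f : M.carrier →+ M.carrier)
    (hf : ∀ x ∈ N.toSub, f x ∈ N.toSub) (x : M.carrier) :
    N.quotMap f hf (Submodule.Quotient.mk x) = Submodule.Quotient.mk (f x) := rfl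

/-- The quotient by a dg submodule. -/
def quot (N : DGSub M) : DGMod R where
  carrier := M.carrier ⧸ N.toSub
  gr i := (M.gr i).map N.toSub.mkQ.toAddMonoidHom
  isInternal := by
    refine isInternal_of_projections _ (fun i => N.quotMap (M.comp i) (N.comp_mem i)) ?_ ?_ ?_
    · rintro i _ ⟨x, hx, rfl⟩
      exact congrArg _ (DGMod.comp_of_mem hx)
    · rintro i j hij _ ⟨x, hx, rfl⟩
      exact congrArg N.toSub.mkQ (DGMod.comp_of_mem_ne hx hij)
    · intro P hP x
      obtain ⟨x, rfl⟩ := Submodule.Quotient.mk_surjective _ x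
      obtain ⟨s, hs⟩ := M.sum_comp x
      rw [hs, ← Submodule.mkQ_apply, map_sum]
      exact P.sum_mem fun i _ => hP i ⟨_, M.comp_mem i x, rfl⟩
  smul_mem := by
    rintro i j _ a ⟨x, hx, rfl⟩ ha
    exact ⟨_, M.smul_mem hx ha, rfl⟩
  d := N.quotMap M.d N.d_mem
  d_mem := by
    rintro i _ ⟨x, hx, rfl⟩
    exact ⟨_, M.d_mem hx, rfl⟩
  d_d x := by
    obtain ⟨x, rfl⟩ := Submodule.Quotient.mk_surjective _ x
    rw [quotMap_mk, quotMap_mk, M.d_d]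
    rfl
  leibniz := by
    rintro i _ ⟨x, hx, rfl⟩ a
    exact (congrArg N.toSub.mkQ (M.leibniz hx a)).trans (by rw [map_add, map_zsmul]; rfl)

/-- The projection onto the quotient by a dg submodule. -/
def proj (N : DGSub M) : M ⟶ N.quot := ⟨N.toSub.mkQ, fun h => ⟨_, h, rfl⟩, fun _ => rfl⟩

lemma proj_surjective (N : DGSub M) : Function.Surjective N.proj.toLin := N.toSub.mkQ_surjective

lemma proj_eq_zero (N : DGSub M) (x : M.carrier) : N.proj.toLin x = 0 ↔ x ∈ N.toSub :=
  Submodule.Quotient.mk_eq_zero _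

/-- The map from the quotient induced by a map that vanishes on the dg submodule. -/
def desc (N : DGSub M) {P : DGMod R} (f : M ⟶ P) (h : ∀ x ∈ N.toSub, f.toLin x = 0) :
    N.quot ⟶ P where
  toLin := N.toSub.liftQ f.toLin h
  map_mem := by
    rintro i _ ⟨x, hx, rfl⟩
    exact f.map_mem hx
  map_d x := by
    obtain ⟨x, rfl⟩ := Submodule.Quotient.mk_surjective _ x
    exact f.map_d x

/-- The kernel of a homomorphism. -/
def ker {P : DGMod R} (f : M ⟶ P) : DGSub M where
  toSub := LinearMap.ker f.toLin
  comp_mem i x hx := by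
    rw [LinearMap.mem_ker] at hx ⊢
    rw [← DGMod.comp_map, hx, map_zero]
  d_mem x hx := by
    rw [LinearMap.mem_ker] at hx ⊢
    rw [f.map_d, hx, map_zero]

/-- The range of a homomorphism. -/
def range {P : DGMod R} (f : P ⟶ M) : DGSub M where
  toSub := LinearMap.range f.toLin
  comp_mem := by
    rintro i _ ⟨x, rfl⟩
    exact ⟨P.comp i x, (DGMod.comp_map f i x).symm⟩
  d_mem := by
    rintro _ ⟨x, rfl⟩
    exact ⟨P.d x, f.map_d x⟩

/-- The preimage of a dg submodule. -/
def comap {P : DGMod R} (f : P ⟶ M) (N : DGSub M) : DGSub P := ker (f ≫ N.proj)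

lemma mem_comap {P : DGMod R} (f : P ⟶ M) (N : DGSub M) (x : P.carrier) :
    x ∈ (comap f N).toSub ↔ f.toLin x ∈ N.toSub := N.proj_eq_zero _

end DGSub

/-! ### Monomorphisms, cokernels and monoform objects among dg modules -/

namespace DGMod

variable {R : DGRing.{u}} {M N P : DGMod R}

@[simp] lemma zero_toLin : Hom.toLin (0 : M ⟶ N) = 0 := rfl

lemma isZero_iff : IsZero M ↔ ∀ x : M.carrier, x = 0 := by
  refine ⟨fun h x => ?_, fun h => (IsZero.iff_id_eq_zero M).2 (hom_ext fun x => ?_)⟩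
  · exact congrArg (fun f : M ⟶ M => f.toLin x) ((IsZero.iff_id_eq_zero M).1 h)
  · exact h x

lemma not_isZero_iff : ¬ IsZero M ↔ ∃ x : M.carrier, x ≠ 0 := by
  rw [isZero_iff]
  push Not
  rfl

lemma mono_iff_injective (f : M ⟶ N) : Mono f ↔ Function.Injective f.toLin := by
  refine ⟨fun h => ?_, fun h => ⟨fun g g' hg => hom_ext fun x => h ?_⟩⟩
  · have : (DGSub.ker f).incl = 0 := by
      rw [← cancel_mono f, zero_comp]
      ext x
      exact x.2
    refine (injective_iff_map_eq_zero _).2 fun x hx => ?_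
    exact congrArg (fun g : (DGSub.ker f).obj ⟶ M => g.toLin ⟨x, hx⟩) this
  · exact congrArg (fun k => Hom.toLin k x) hg

lemma surjective_of_epi (f : M ⟶ N) [Epi f] : Function.Surjective f.toLin := by
  have : (DGSub.range f).proj = 0 := by
    rw [← cancel_epi f, comp_zero]
    ext x
    exact ((DGSub.range f).proj_eq_zero _).2 ⟨x, rfl⟩
  intro y
  exact ((DGSub.range f).proj_eq_zero y).1 (by rw [this]; rfl)

lemma epi_of_surjective (f : M ⟶ N) (hf : Function.Surjective f.toLin) : Epi f :=
  ⟨fun g g' hg => hom_ext fun y => by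
    obtain ⟨x, rfl⟩ := hf y
    exact congrArg (fun k => Hom.toLin k x) hg⟩

/-- The quotient by the range is the cokernel. -/
def isColimitProj (f : P ⟶ M) (L : DGSub M) (h : ∀ x, x ∈ L.toSub ↔ ∃ y, f.toLin y = x)
    (w : f ≫ L.proj = 0) : IsColimit (CokernelCofork.ofπ L.proj w) :=
  CokernelCofork.IsColimit.ofπ _ _
    (fun g hg => L.desc g fun x hx => by
      obtain ⟨y, rfl⟩ := (h x).1 hx
      exact congrArg (fun k => Hom.toLin k y) hg)
    (fun g hg => hom_ext fun x => rfl)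
    (fun g hg m hm => hom_ext fun x => by
      obtain ⟨x, rfl⟩ := L.proj_surjective x
      exact congrArg (fun k => Hom.toLin k x) hm)

lemma not_common_of_isMonoform (hM : IsMonoform M) {L : DGSub M} {l : M.carrier}
    (hl : l ∈ L.toSub) (hl0 : l ≠ 0) : ¬ HaveCommonNonzeroSubobject M L.quot := by
  have w : L.incl ≫ L.proj = 0 := hom_ext fun x => (L.proj_eq_zero _).2 x.2
  refine hM.2 L.obj L.incl ((mono_iff_injective _).2 L.incl_injective)
    (not_isZero_iff.2 ⟨(⟨l, hl⟩ : L.toSub), fun h => hl0 (congrArg Subtype.val h)⟩) L.quot L.proj w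
    ⟨isColimitProj _ _ (fun x => ⟨fun hx => ⟨(⟨x, hx⟩ : L.toSub), rfl⟩, ?_⟩) w⟩
  rintro ⟨y, rfl⟩
  exact y.2

lemma isMonoform_of_not_common {m : M.carrier} (hm : m ≠ 0)
    (h : ∀ (L : DGSub M) (l : M.carrier), l ∈ L.toSub → l ≠ 0 →
      ¬ HaveCommonNonzeroSubobject M L.quot) : IsMonoform M := by
  refine ⟨not_isZero_iff.2 ⟨m, hm⟩, fun K i hi hK Q p w ⟨hp⟩ hc => ?_⟩
  obtain ⟨k, hk⟩ := not_isZero_iff.1 hK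
  rw [mono_iff_injective] at hi
  have w' : i ≫ (DGSub.range i).proj = 0 := hom_ext fun x => (DGSub.proj_eq_zero _ _).2 ⟨x, rfl⟩
  let e : Q ≅ (DGSub.range i).quot :=
    hp.coconePointUniqueUpToIso (isColimitProj i (DGSub.range i) (fun x => Iff.rfl) w')
  exact h (DGSub.range i) (i.toLin k) ⟨k, rfl⟩ ((map_ne_zero_iff _ hi).2 hk)
    (hc.of_mono (𝟙 M) e.hom)

/-- Nonzero subobjects of monoform objects are monoform. -/
lemma isMonoform_of_mono (hM : IsMonoform M) (f : N ⟶ M) [Mono f] (hN : ¬ IsZero N) :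
    IsMonoform N := by
  have hf := (mono_iff_injective f).1 inferInstance
  obtain ⟨n, hn⟩ := not_isZero_iff.1 hN
  refine isMonoform_of_not_common hn fun L l hl hl0 hc => ?_
  let K : DGSub M := DGSub.range (L.incl ≫ f)
  have hK : ∀ x, f.toLin x ∈ K.toSub ↔ x ∈ L.toSub := by
    refine fun x => ⟨?_, fun hx => ⟨⟨x, hx⟩, rfl⟩⟩
    rintro ⟨y, hy⟩
    rw [← hf hy]
    exact y.2
  -- `N/L` embeds in `M/f(L)`, so a common subobject of `N` and `N/L` is also one of `M` and
  -- `M/f(L)`.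
  let g : L.quot ⟶ K.quot := L.desc (f ≫ K.proj) fun x hx => (K.proj_eq_zero _).2 ((hK x).2 hx)
  have : Mono g := by
    rw [mono_iff_injective]
    refine (injective_iff_map_eq_zero _).2 fun x hx => ?_
    obtain ⟨x, rfl⟩ := L.proj_surjective x
    exact (L.proj_eq_zero x).2 ((hK x).1 ((K.proj_eq_zero _).1 hx))
  exact not_common_of_isMonoform hM ((hK l).2 hl) ((map_ne_zero_iff _ hf).2 hl0) (hc.of_mono f g)

/-- A homomorphism with values in the range of an injective homomorphism factors through it. -/
lemma exists_factor (f : N ⟶ M) (g : P ⟶ M) (hg : Function.Injective g.toLin)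
    (h : ∀ x, ∃ y, g.toLin y = f.toLin x) : ∃ k : N ⟶ P, k ≫ g = f := by
  choose s hs using h
  exact ⟨{
    toLin :=
      { toFun := s
        map_add' := fun a b => hg (by simp only [hs, map_add])
        map_smul' := fun a b => hg (by simp only [hs, map_smul, RingHom.id_apply]) }
    map_mem := fun {i x} hx => mem_gr_of_map g hg ((hs x).symm ▸ f.map_mem hx)
    map_d := fun x => hg ((hs _).trans (by
      rw [g.map_d, f.map_d]
      exact congrArg M.d (hs x).symm)) }, hom_ext hs⟩

/-- Monoform objects are uniform. -/
lemma haveCommon_of_isMonoform (hM : IsMonoform M) (f : N ⟶ M) (g : P ⟶ M) [Mono f] [Mono g]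
    (hN : ¬ IsZero N) (hP : ¬ IsZero P) : HaveCommonNonzeroSubobject N P := by
  have hf := (mono_iff_injective f).1 inferInstance
  have hg := (mono_iff_injective g).1 inferInstance
  obtain ⟨y, hy⟩ := not_isZero_iff.1 hP
  let K := DGSub.range g
  by_cases h : ∃ x : N.carrier, x ≠ 0 ∧ f.toLin x ∈ K.toSub
  · obtain ⟨x, hx0, hx⟩ := h
    let W := DGSub.comap f K
    have hW : Mono W.incl := (mono_iff_injective _).2 W.incl_injective
    obtain ⟨k, hk⟩ := exists_factor (W.incl ≫ f) g hg fun w => (DGSub.mem_comap f K _).1 w.2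
    have : Mono (k ≫ g) := hk ▸ mono_comp _ _
    exact ⟨W.obj, not_isZero_iff.2 ⟨(⟨x, (DGSub.mem_comap f K x).2 hx⟩ : W.toSub),
      fun h => hx0 (congrArg Subtype.val h)⟩, ⟨W.incl, hW⟩, ⟨k, mono_of_mono k g⟩⟩
  -- If `N` and `P` met trivially inside `M`, then `N` would embed in `M/P`, contrary to
  -- monoformity.
  · exfalso
    push Not at h
    refine not_common_of_isMonoform hM (L := K) (l := g.toLin y) ⟨y, rfl⟩
      ((map_ne_zero_iff _ hg).2 hy) ⟨N, hN, ⟨f, inferInstance⟩, ⟨f ≫ K.proj, ?_⟩⟩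
    rw [mono_iff_injective]
    refine (injective_iff_map_eq_zero _).2 fun x hx => ?_
    by_contra hx0
    exact h x hx0 ((K.proj_eq_zero _).1 hx)

/-- The two given subobjects of `N` intersect nontrivially because `N` is uniform. -/
lemma haveCommon_trans (hN : IsMonoform N) (h₁ : HaveCommonNonzeroSubobject M N)
    (h₂ : HaveCommonNonzeroSubobject N P) : HaveCommonNonzeroSubobject M P := by
  obtain ⟨Z, hZ, ⟨f, _⟩, ⟨g, _⟩⟩ := h₁
  obtain ⟨W, hW, ⟨f', _⟩, ⟨g', _⟩⟩ := h₂
  exact (haveCommon_of_isMonoform hN g f' hZ hW).of_mono f g'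

lemma atom_eq_iff (hM : IsMonoform M) (hN : IsMonoform N) :
    AtomSpectrum.mk M hM = AtomSpectrum.mk N hN ↔ HaveCommonNonzeroSubobject M N := by
  have e : Equivalence fun H K : {X : DGMod R // IsMonoform X} =>
      HaveCommonNonzeroSubobject H.1 K.1 :=
    ⟨fun X => ⟨X.1, X.2.1, ⟨𝟙 _, inferInstance⟩, ⟨𝟙 _, inferInstance⟩⟩,
      fun ⟨Z, hZ, f, g⟩ => ⟨Z, hZ, g, f⟩, fun {X Y Z} h h' => haveCommon_trans Y.2 h h'⟩
  exact e.quot_mk_eq_iff ⟨M, hM⟩ ⟨N, hN⟩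

end DGMod

/-! ### Dg ideals of a noetherian dg ring -/

namespace DGRing

variable {R : DGRing.{u}}

lemma comp_mem (i : ℤ) (a : R.carrier) : R.comp i a ∈ R.gr i :=
  SetLike.coe_mem (DirectSum.decompose R.gr a i)

lemma sum_comp (a : R.carrier) : ∃ s : Finset ℤ, a = ∑ i ∈ s, R.comp i a := by
  classical
  exact ⟨_, (DirectSum.sum_support_decompose R.gr a).symm⟩

lemma mul_mem_gr {i j k : ℤ} (h : i + j = k) {a b : R.carrier} (ha : a ∈ R.gr i)
    (hb : b ∈ R.gr j) : a * b ∈ R.gr k :=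
  h ▸ SetLike.GradedMul.mul_mem ha hb

lemma d_of_mem_zero (hR : R.IsNonpositive) {a : R.carrier} (ha : a ∈ R.gr 0) : R.d a = 0 :=
  eq_zero_of_pos hR (by norm_num) (R.d_mem ha)

lemma mul_comm_of_mem_zero (hR : R.IsSkewCommutative) {r : R.carrier} (hr : r ∈ R.gr 0)
    (a : R.carrier) : r * a = a * r := by
  induction a using homogeneous_induction with
  | h0 => simp
  | hadd a b ha hb => rw [mul_add, add_mul, ha, hb]
  | hh i a ha => simpa using hR 0 i r a hr ha

lemma zero_mul_comm (hR : R.IsSkewCommutative) (a b : (R.Zero)ᵐᵒᵖ) : a * b = b * a := by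
  apply unop_injective
  apply Subtype.ext
  exact mul_comm_of_mem_zero hR b.unop.2 a.unop

lemma isRightDGIdeal_of_homogeneous {I : AddSubgroup R.carrier}
    (hcomp : ∀ x ∈ I, ∀ i, R.comp i x ∈ I)
    (hmul : ∀ i j, ∀ x ∈ I, x ∈ R.gr i → ∀ a ∈ R.gr j, x * a ∈ I)
    (hd : ∀ i, ∀ x ∈ I, x ∈ R.gr i → R.d x ∈ I) : R.IsRightDGIdeal I := by
  refine fun x hx => ⟨fun a => ?_, hcomp x hx, ?_⟩
  · induction a using homogeneous_induction with
    | h0 => simp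
    | hadd a b ha hb => rw [mul_add]; exact I.add_mem ha hb
    | hh j a ha =>
      obtain ⟨s, hs⟩ := sum_comp x
      rw [hs, Finset.sum_mul]
      exact I.sum_mem fun i _ => hmul i j _ (hcomp x hx i) (comp_mem i x) a ha
  · obtain ⟨s, hs⟩ := sum_comp x
    rw [hs, map_sum]
    exact I.sum_mem fun i _ => hd i _ (hcomp x hx i) (comp_mem i x)

/-- The chain condition gives a maximal member, and directedness makes it the greatest. This is the
source of the uniform multipliers used for socle elements. -/
lemma exists_greatest_of_directed (hn : R.IsRightDGNoetherian) {ι : Type*} [Nonempty ι]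
    (K : ι → AddSubgroup R.carrier) (hK : ∀ i, R.IsRightDGIdeal (K i)) (hdir : Directed (· ≤ ·) K) :
    ∃ i, ∀ j, K j ≤ K i := by
  have : WellFoundedGT {I : AddSubgroup R.carrier // R.IsRightDGIdeal I} := by
    rw [wellFoundedGT_iff_monotone_chain_condition]
    intro f
    obtain ⟨n, h⟩ := hn ⟨fun n => (f n).1, fun _ _ h => f.monotone h⟩ fun n => (f n).2
    exact ⟨n, fun m hm => Subtype.ext (h m hm)⟩
  obtain ⟨_, ⟨i, rfl⟩, hi⟩ := this.wf.has_min
    (Set.range fun i => (⟨K i, hK i⟩ : {I : AddSubgroup R.carrier // R.IsRightDGIdeal I}))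
    (Set.range_nonempty _)
  refine ⟨i, fun j => ?_⟩
  obtain ⟨k, hik, hjk⟩ := hdir i j
  have h := eq_of_le_of_not_lt (α := {I : AddSubgroup R.carrier // R.IsRightDGIdeal I}) hik
    (hi _ ⟨k, rfl⟩)
  exact hjk.trans (congrArg Subtype.val h).ge

/-- The right dg ideal generated by an ideal of `R⁰`. -/
def extend (I : Ideal (R.Zero)ᵐᵒᵖ) : AddSubgroup R.carrier :=
  AddSubgroup.closure {x | ∃ r ∈ I, ∃ a, x = (r.unop : R.carrier) * a}

lemma extend_isRightDGIdeal (hR : R.IsNonpositive) (I : Ideal (R.Zero)ᵐᵒᵖ) :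
    R.IsRightDGIdeal (extend I) := by
  refine fun x hx => ⟨fun b => ?_, fun i => ?_, ?_⟩
  · refine AddSubgroup.closure_induction (p := fun x _ => x * b ∈ extend I) ?_ ?_ ?_ ?_ hx
    · rintro _ ⟨r, hr, a, rfl⟩
      exact AddSubgroup.subset_closure ⟨r, hr, a * b, mul_assoc _ _ _⟩
    · simp
    · intro x y _ _ hx hy
      rw [add_mul]
      exact add_mem hx hy
    · intro x _ hx
      rw [neg_mul]
      exact neg_mem hx
  · refine AddSubgroup.closure_induction (p := fun x _ => R.comp i x ∈ extend I) ?_ ?_ ?_ ?_ hx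
    · rintro _ ⟨r, hr, a, rfl⟩
      refine AddSubgroup.subset_closure ⟨r, hr, R.comp i a, ?_⟩
      induction a using homogeneous_induction with
      | h0 => simp
      | hadd a b ha hb => rw [mul_add, map_add, ha, hb, map_add, mul_add]
      | hh j a ha =>
        have h := mul_mem_gr (zero_add j) r.unop.2 ha
        by_cases hij : j = i
        · subst hij
          rw [comp_of_mem ha, comp_of_mem h]
        · rw [comp_of_mem_ne ha hij, comp_of_mem_ne h hij, mul_zero]
    · simp
    · intro x y _ _ hx hy
      rw [map_add]
      exact add_mem hx hy
    · intro x _ hx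
      rw [map_neg]
      exact neg_mem hx
  · refine AddSubgroup.closure_induction (p := fun x _ => R.d x ∈ extend I) ?_ ?_ ?_ ?_ hx
    · rintro _ ⟨r, hr, a, rfl⟩
      refine AddSubgroup.subset_closure ⟨r, hr, R.d a, ?_⟩
      rw [R.leibniz r.unop.2, d_of_mem_zero hR r.unop.2]
      simp
    · simp
    · intro x y _ _ hx hy
      rw [map_add]
      exact add_mem hx hy
    · intro x _ hx
      rw [map_neg]
      exact neg_mem hx

/-- In the absence of positive degrees `comp0` is multiplicative, so it maps the dg ideal generated
by `I` back into `I`. Ascending chains in `R⁰` can therefore be tested on dg ideals of `R`. -/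
lemma mem_extend (hR : R.IsNonpositive) (I : Ideal (R.Zero)ᵐᵒᵖ) (r : (R.Zero)ᵐᵒᵖ) :
    (r.unop : R.carrier) ∈ extend I ↔ r ∈ I := by
  refine ⟨fun h => ?_, fun h => AddSubgroup.subset_closure ⟨r, h, 1, (mul_one _).symm⟩⟩
  have key : ∀ x ∈ extend I, op (R.comp0 x) ∈ I := fun x hx => by
    refine AddSubgroup.closure_induction (p := fun x _ => op (R.comp0 x) ∈ I) ?_ ?_ ?_ ?_ hx
    · rintro _ ⟨r, hr, a, rfl⟩
      have : R.comp0 (r.unop : R.carrier) = r.unop := Subtype.ext (comp_of_mem r.unop.2)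
      rw [comp0_mul hR, op_mul, this]
      exact I.mul_mem_left _ hr
    · simp
    · intro x y _ _ hx hy
      rw [map_add]
      exact add_mem hx hy
    · intro x _ hx
      rw [map_neg]
      exact neg_mem hx
  have : op (R.comp0 (r.unop : R.carrier)) = r :=
    unop_injective (Subtype.ext (comp_of_mem r.unop.2))
  rw [← this]
  exact key _ h

lemma isNoetherianRing_zero (hR : R.IsNonpositive) (hn : R.IsRightDGNoetherian) :
    IsNoetherianRing (R.Zero)ᵐᵒᵖ := by
  refine monotone_stabilizes_iff_noetherian.1 fun f => ?_
  obtain ⟨n, h⟩ := hn ⟨fun n => extend (f n), fun i j hij => AddSubgroup.closure_mono (by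
    rintro _ ⟨r, hr, a, rfl⟩
    exact ⟨r, f.monotone hij hr, a, rfl⟩)⟩ fun n => extend_isRightDGIdeal hR _
  refine ⟨n, fun m hm => ?_⟩
  ext r
  rw [← mem_extend hR, ← mem_extend hR]
  exact iff_of_eq (congrArg (fun J => (r.unop : R.carrier) ∈ J) (h m hm))

end DGRing

/-! ### The action of the degree-zero part -/

namespace DGMod

variable {R : DGRing.{u}} {M N : DGMod R}

instance zeroModule (M : DGMod R) : Module (R.Zero)ᵐᵒᵖ M.carrier :=
  Module.compHom M.carrier (RingHom.op R.zeroIncl)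

lemma zero_smul_eq (r : (R.Zero)ᵐᵒᵖ) (x : M.carrier) : r • x = op (r.unop : R.carrier) • x := rfl

/-- A homomorphism of dg modules as an `R⁰`-linear map. -/
def Hom.toZeroLin (f : M ⟶ N) : M.carrier →ₗ[(R.Zero)ᵐᵒᵖ] N.carrier where
  toFun := f.toLin
  map_add' := map_add f.toLin
  map_smul' r x := f.toLin.map_smul (op (r.unop : R.carrier)) x

lemma Hom.toZeroLin_apply (f : M ⟶ N) (x : M.carrier) : f.toZeroLin x = f.toLin x := rfl

lemma zero_smul_mem {i : ℤ} {x : M.carrier} (hx : x ∈ M.gr i) (r : (R.Zero)ᵐᵒᵖ) :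
    r • x ∈ M.gr i := by
  have h := M.smul_mem hx r.unop.2
  rwa [add_zero] at h

lemma comp_zero_smul (i : ℤ) (r : (R.Zero)ᵐᵒᵖ) (x : M.carrier) :
    M.comp i (r • x) = r • M.comp i x :=
  M.comp_smul_of_mem (add_zero i) x r.unop.2

lemma d_zero_smul (hR : R.IsNonpositive) (r : (R.Zero)ᵐᵒᵖ) (x : M.carrier) :
    M.d (r • x) = r • M.d x := by
  induction x using homogeneous_induction with
  | h0 => simp
  | hadd x y hx hy => simp only [smul_add, map_add, hx, hy]
  | hh i x hx =>
    rw [zero_smul_eq, M.leibniz hx, DGRing.d_of_mem_zero hR r.unop.2]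
    simp [zero_smul_eq]

lemma op_smul_zero_smul (hR : R.IsSkewCommutative) (a : R.carrier) (r : (R.Zero)ᵐᵒᵖ)
    (x : M.carrier) : op a • r • x = r • op a • x := by
  rw [zero_smul_eq, zero_smul_eq, smul_smul, smul_smul, ← op_mul, ← op_mul,
    DGRing.mul_comm_of_mem_zero hR r.unop.2]

/-! ### Cyclic dg submodules -/

/-- The dg submodule generated by a homogeneous element. -/
def gen {m : ℤ} (x : M.carrier) (hx : x ∈ M.gr m) : DGSub M where
  toSub := Submodule.span _ {x, M.d x}
  comp_mem i z hz := by
    obtain ⟨a, b, rfl⟩ := Submodule.mem_span_pair.1 hz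
    rw [map_add, ← op_unop a, ← op_unop b, M.comp_mem_smul (j := i - m) (by omega) hx,
      M.comp_mem_smul (j := i - (m + 1)) (by omega) (M.d_mem hx)]
    exact Submodule.mem_span_pair.2 ⟨_, _, rfl⟩
  d_mem z hz := by
    obtain ⟨a, b, rfl⟩ := Submodule.mem_span_pair.1 hz
    have h1 : x ∈ Submodule.span (R.carrier)ᵐᵒᵖ {x, M.d x} := Submodule.mem_span_of_mem (by simp)
    have h2 : M.d x ∈ Submodule.span (R.carrier)ᵐᵒᵖ {x, M.d x} :=
      Submodule.mem_span_of_mem (by simp)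
    rw [map_add, ← op_unop a, ← op_unop b, M.leibniz hx, M.leibniz (M.d_mem hx), M.d_d, smul_zero]
    exact add_mem (add_mem (Submodule.smul_mem _ _ h2) (zsmul_mem (Submodule.smul_mem _ _ h1) _))
      (add_mem (zero_mem _) (zsmul_mem (Submodule.smul_mem _ _ h2) _))

lemma mem_gen {m : ℤ} {x : M.carrier} (hx : x ∈ M.gr m) (z : M.carrier) :
    z ∈ (gen x hx).toSub ↔ ∃ a b : R.carrier, op a • x + op b • M.d x = z :=
  Submodule.mem_span_pair.trans
    ⟨fun ⟨a, b, h⟩ => ⟨a.unop, b.unop, h⟩, fun ⟨a, b, h⟩ => ⟨op a, op b, h⟩⟩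

/-- Homogeneous elements of the same degree that satisfy the same relations generate isomorphic
dg submodules. -/
lemma haveCommon_of_relations {m : ℤ} {x : M.carrier} {y : N.carrier} (hx : x ∈ M.gr m)
    (hy : y ∈ N.gr m) (hx0 : x ≠ 0)
    (h : ∀ a b : R.carrier, op a • x + op b • M.d x = 0 ↔ op a • y + op b • N.d y = 0) :
    HaveCommonNonzeroSubobject M N := by
  let Z := gen x hx
  have hZ : ∀ z : Z.obj.carrier, ∃ w : N.carrier, ∃ a b : R.carrier,
      op a • x + op b • M.d x = Z.incl.toLin z ∧ op a • y + op b • N.d y = w := fun z => by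
    obtain ⟨a, b, hab⟩ := (mem_gen hx _).1 z.2
    exact ⟨_, a, b, hab, rfl⟩
  choose f hf using hZ
  -- The coefficients chosen for `z` are not unique; the equality of relations makes the value of
  -- `f` independent of them. The compatibilities below are then checked on convenient coefficients.
  have spec : ∀ (z : Z.obj.carrier) (a b : R.carrier),
      Z.incl.toLin z = op a • x + op b • M.d x → f z = op a • y + op b • N.d y := by
    intro z a b hz
    obtain ⟨a', b', h1, h2⟩ := hf z
    have h3 : op (a - a') • x + op (b - b') • M.d x = 0 := by
      rw [MulOpposite.op_sub, MulOpposite.op_sub, sub_smul, sub_smul, sub_add_sub_comm, ← hz, h1, sub_self]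
    have h4 := (h _ _).1 h3
    rw [MulOpposite.op_sub, MulOpposite.op_sub, sub_smul, sub_smul, sub_add_sub_comm, h2, sub_eq_zero] at h4
    exact h4.symm
  have hadd : ∀ z w, f (z + w) = f z + f w := fun z w => by
    obtain ⟨a, b, h1, h2⟩ := hf z
    obtain ⟨a', b', h3, h4⟩ := hf w
    rw [spec (z + w) (a + a') (b + b') (by
      rw [map_add, ← h1, ← h3]
      simp only [MulOpposite.op_add, add_smul]
      abel), ← h2, ← h4]
    simp only [MulOpposite.op_add, add_smul]
    abel
  have hsmul : ∀ (c : (R.carrier)ᵐᵒᵖ) z, f (c • z) = c • f z := fun c z => by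
    obtain ⟨a, b, h1, h2⟩ := hf z
    rw [spec (c • z) (a * c.unop) (b * c.unop)
      (by rw [map_smul, ← h1]; simp only [op_mul, op_unop, mul_smul, smul_add]), ← h2]
    simp only [op_mul, op_unop, mul_smul, smul_add]
  have hd : ∀ z, f (Z.obj.d z) = N.d (f z) := fun z => by
    obtain ⟨a, b, h1, h2⟩ := hf z
    rw [← h2, map_add, N.leibniz hy, N.leibniz (N.d_mem hy), N.d_d,
      spec (Z.obj.d z) ((m.negOnePow : ℤ) • R.d a) (a + ((m + 1).negOnePow : ℤ) • R.d b)]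
    · simp only [MulOpposite.op_add, op_smul, add_smul, smul_assoc, smul_zero]
      abel
    · rw [Z.incl.map_d, ← h1, map_add, M.leibniz hx, M.leibniz (M.d_mem hx), M.d_d]
      simp only [MulOpposite.op_add, op_smul, add_smul, smul_assoc, smul_zero]
      abel
  have hcomp : ∀ i z, f (Z.obj.comp i z) = N.comp i (f z) := fun i z => by
    obtain ⟨a, b, h1, h2⟩ := hf z
    rw [← h2, map_add, N.comp_mem_smul (j := i - m) (by omega) hy,
      N.comp_mem_smul (j := i - (m + 1)) (by omega) (N.d_mem hy)]
    apply spec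
    rw [← comp_map, ← h1, map_add, M.comp_mem_smul (j := i - m) (by omega) hx,
      M.comp_mem_smul (j := i - (m + 1)) (by omega) (M.d_mem hx)]
  let g : Z.obj ⟶ N :=
    { toLin := { toFun := f, map_add' := hadd, map_smul' := hsmul }
      map_mem := fun {i z} hz => by
        change f z ∈ N.gr i
        rw [← comp_of_mem hz, hcomp]
        exact N.comp_mem i _
      map_d := hd }
  refine ⟨Z.obj, not_isZero_iff.2 ⟨(⟨x, (mem_gen hx x).2 ⟨1, 0, by simp⟩⟩ : Z.toSub),
    fun h => hx0 (congrArg Subtype.val h)⟩, ⟨Z.incl, (mono_iff_injective _).2 Z.incl_injective⟩,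
    ⟨g, (mono_iff_injective _).2 ((injective_iff_map_eq_zero _).2 fun z hz => ?_)⟩⟩
  obtain ⟨a, b, h1, h2⟩ := hf z
  apply Z.incl_injective
  rw [map_zero, ← h1]
  exact (h a b).2 (h2.trans hz)

end DGMod

namespace DGMod

variable {R : DGRing.{u}} {M N : DGMod R}

/-! ### Socle elements -/

lemma zero_smul_zero (x : M.carrier) : (0 : (R.Zero)ᵐᵒᵖ) • x = 0 :=
  zero_smul (R.Zero)ᵐᵒᵖ x

lemma op_zero_smul (x : M.carrier) : (op (0 : R.Zero) : (R.Zero)ᵐᵒᵖ) • x = 0 :=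
  zero_smul_zero x

/-- A homogeneous element annihilated by the negative part of `R`, and with annihilator `p` in
`R⁰`. -/
structure IsSocleElement (p : Ideal (R.Zero)ᵐᵒᵖ) (m : ℤ) (x : M.carrier) : Prop where
  mem : x ∈ M.gr m
  ann : HasAnn p x
  neg_smul : ∀ j < 0, ∀ a ∈ R.gr j, op a • x = 0

namespace IsSocleElement

variable {p : Ideal (R.Zero)ᵐᵒᵖ} {m : ℤ} {x : M.carrier}

lemma op_smul (hR : R.IsNonpositive) (hx : IsSocleElement p m x) (a : R.carrier) :
    op a • x = op (R.comp0 a) • x := by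
  induction a using DGRing.homogeneous_induction with
  | h0 => rw [map_zero, op_zero_smul, MulOpposite.op_zero, _root_.zero_smul]
  | hadd a b ha hb => rw [map_add, MulOpposite.op_add, MulOpposite.op_add, add_smul, add_smul, ha, hb]
  | hh j a ha =>
    rcases lt_trichotomy j 0 with hj | rfl | hj
    · rw [hx.neg_smul j hj a ha, DGRing.comp0_of_mem_ne ha hj.ne, op_zero_smul]
    · rw [zero_smul_eq]
      exact congrArg (fun b => op b • x) (DGRing.comp_of_mem ha).symm
    · rw [DGRing.eq_zero_of_pos hR hj ha, map_zero, op_zero_smul, MulOpposite.op_zero, _root_.zero_smul]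

/-- For `a` of negative degree, `x·a = 0`, and the Leibniz rule for `d(x·a) = 0` gives `dx·a =
-(-1)^m x·d(a)`; only `a` of degree `-1` contributes. -/
lemma op_smul_d (hR : R.IsNonpositive) (hx : IsSocleElement p m x) (a : R.carrier) :
    op a • M.d x = op (R.comp0 a) • M.d x - (m.negOnePow : ℤ) • op (R.dComp a) • x := by
  induction a using DGRing.homogeneous_induction with
  | h0 =>
    rw [map_zero, map_zero, op_zero_smul, op_zero_smul, MulOpposite.op_zero,
      _root_.zero_smul, smul_zero, sub_zero]
  | hadd a b ha hb =>
    rw [map_add, map_add, MulOpposite.op_add, MulOpposite.op_add, MulOpposite.op_add, add_smul, add_smul,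
      add_smul, ha, hb, smul_add]
    abel
  | hh j a ha =>
    rcases lt_trichotomy j 0 with hj | rfl | hj
    · have h1 := M.leibniz hx.mem a
      rw [hx.neg_smul j hj a ha, map_zero, hx.op_smul hR (R.d a), DGRing.comp0_d] at h1
      rw [DGRing.comp0_of_mem_ne ha hj.ne, op_zero_smul, zero_sub]
      exact eq_neg_of_add_eq_zero_left h1.symm
    · rw [DGRing.dComp_of_mem_ne ha (by norm_num), op_zero_smul, smul_zero, sub_zero,
        zero_smul_eq]
      exact congrArg (fun b => op b • M.d x) (DGRing.comp_of_mem ha).symm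
    · rw [DGRing.eq_zero_of_pos hR hj ha, map_zero, map_zero, op_zero_smul, op_zero_smul, MulOpposite.op_zero,
      _root_.zero_smul, smul_zero, sub_zero]

/-- After rewriting the action through `R⁰`, the relation splits into its components in degrees `m`
and `m + 1`. -/
lemma relation_iff (hR : R.IsNonpositive) (hx : IsSocleElement p m x) (a b : R.carrier) :
    op a • x + op b • M.d x = 0 ↔
      op (R.comp0 a) - (m.negOnePow : ℤ) • op (R.dComp b) ∈ p ∧ op (R.comp0 b) • M.d x = 0 := by
  have h : op a • x + op b • M.d x =
      (op (R.comp0 a) - (m.negOnePow : ℤ) • op (R.dComp b)) • x + op (R.comp0 b) • M.d x := by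
    rw [hx.op_smul hR, hx.op_smul_d hR, sub_smul, smul_assoc]
    abel
  rw [h, ← hx.ann]
  refine ⟨fun h0 => ?_, fun ⟨h1, h2⟩ => by rw [h1, h2, add_zero]⟩
  have h1 := congrArg (M.comp m) h0
  have h2 := congrArg (M.comp (m + 1)) h0
  rw [map_add, map_zero, comp_of_mem (zero_smul_mem hx.mem _),
    comp_of_mem_ne (zero_smul_mem (M.d_mem hx.mem) _) (by omega), add_zero] at h1
  rw [map_add, map_zero, comp_of_mem_ne (zero_smul_mem hx.mem _) (by omega),
    comp_of_mem (zero_smul_mem (M.d_mem hx.mem) _), zero_add] at h2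
  exact ⟨h1, h2⟩

lemma haveCommon (hR : R.IsNonpositive) [p.IsPrime] {y : N.carrier} (hx : IsSocleElement p m x)
    (hy : IsSocleElement p m y) (h : ∀ r : (R.Zero)ᵐᵒᵖ, r • M.d x = 0 ↔ r • N.d y = 0) :
    HaveCommonNonzeroSubobject M N :=
  haveCommon_of_relations hx.mem hy.mem hx.ann.ne_zero fun a b => by
    rw [hx.relation_iff hR, hy.relation_iff hR, h]

lemma map (hx : IsSocleElement p m x) (f : M ⟶ N) (hf : Function.Injective f.toLin) :
    IsSocleElement p m (f.toLin x) :=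
  ⟨f.map_mem hx.mem, hx.ann.map f.toZeroLin hf, fun j hj a ha => by
    rw [← map_smul, hx.neg_smul j hj a ha, map_zero]⟩

lemma zero_smul (hA : R.IsSkewCommutative) [p.IsPrime] (hx : IsSocleElement p m x)
    {r : (R.Zero)ᵐᵒᵖ} (hr : r ∉ p) : IsSocleElement p m (r • x) :=
  ⟨zero_smul_mem hx.mem r, hx.ann.smul (DGRing.zero_mul_comm hA) hr, fun j hj a ha => by
    rw [op_smul_zero_smul hA, hx.neg_smul j hj a ha, smul_zero]⟩

end IsSocleElement

/-! ### Existence of socle elements -/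

/-- The elements that annihilate `w` together with their differential. -/
def annWithD (w : M.carrier) : AddSubgroup R.carrier where
  carrier := {a | op a • w = 0 ∧ op (R.d a) • w = 0}
  zero_mem' := by simp
  add_mem' {a b} ha hb := by
    simp only [Set.mem_ofPred_eq, map_add, MulOpposite.op_add, add_smul] at *
    rw [ha.1, ha.2, hb.1, hb.2, add_zero]
    exact ⟨rfl, rfl⟩
  neg_mem' {a} ha := by
    simp only [Set.mem_ofPred_eq, map_neg, MulOpposite.op_neg, neg_smul] at *
    rw [ha.1, ha.2, neg_zero]
    exact ⟨rfl, rfl⟩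

lemma op_comp_smul_eq_zero {m : ℤ} {w : M.carrier} (hw : w ∈ M.gr m) {a : R.carrier}
    (ha : op a • w = 0) (i : ℤ) : op (R.comp i a) • w = 0 := by
  rw [← M.comp_mem_smul (k := m + i) rfl hw, ha, map_zero]

lemma annWithD_isRightDGIdeal {m : ℤ} {w : M.carrier} (hw : w ∈ M.gr m) :
    R.IsRightDGIdeal (annWithD w) := by
  refine DGRing.isRightDGIdeal_of_homogeneous ?_ ?_ ?_
  · rintro x ⟨h1, h2⟩ i
    refine ⟨op_comp_smul_eq_zero hw h1 i, ?_⟩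
    rw [← DGRing.comp_d rfl]
    exact op_comp_smul_eq_zero hw h2 _
  · rintro i j x ⟨h1, h2⟩ hx a ha
    refine ⟨by rw [op_mul, mul_smul, h1, smul_zero], ?_⟩
    rw [R.leibniz hx, MulOpposite.op_add, add_smul, MulOpposite.op_smul, smul_assoc, op_mul, op_mul, mul_smul,
      mul_smul, h1, h2, smul_zero, smul_zero, smul_zero, add_zero]
  · rintro i x ⟨h1, h2⟩ hx
    refine ⟨h2, ?_⟩
    rw [R.d_d, MulOpposite.op_zero, _root_.zero_smul]

/-- The elements whose component of degree `-1` annihilates `w` and whose component of degree `0`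
annihilates `w` after multiplication with `R⁻¹`. -/
def annNegOne (w : M.carrier) : AddSubgroup R.carrier where
  carrier := {a | op (R.comp (-1) a) • w = 0 ∧ ∀ b ∈ R.gr (-1), op (R.comp 0 a * b) • w = 0}
  zero_mem' := by simp
  add_mem' {a b} ha hb := by
    simp only [Set.mem_ofPred_eq, map_add, MulOpposite.op_add, add_smul, add_mul] at *
    refine ⟨by rw [ha.1, hb.1, add_zero], fun c hc => by rw [ha.2 c hc, hb.2 c hc, add_zero]⟩
  neg_mem' {a} ha := by
    simp only [Set.mem_ofPred_eq, map_neg, MulOpposite.op_neg, neg_smul, neg_mul] at *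
    refine ⟨by rw [ha.1, neg_zero], fun c hc => by rw [ha.2 c hc, neg_zero]⟩

/-- The condition in degree `0` makes the set stable under multiplication into degree `-1`; the
hypothesis on `d(R⁻²)` makes it stable under the differential. -/
lemma annNegOne_isRightDGIdeal (hR : R.IsNonpositive) {w : M.carrier}
    (hw : ∀ c ∈ R.gr (-2), op (R.d c) • w = 0) : R.IsRightDGIdeal (annNegOne w) := by
  have hcc : ∀ i j (x : R.carrier), R.comp j (R.comp i x) = if i = j then R.comp i x else 0 := by
    intro i j x
    split_ifs with h
    · rw [← h, DGRing.comp_of_mem (DGRing.comp_mem i x)]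
    · exact DGRing.comp_of_mem_ne (DGRing.comp_mem i x) h
  refine DGRing.isRightDGIdeal_of_homogeneous ?_ ?_ ?_
  · rintro x ⟨h1, h2⟩ i
    refine ⟨?_, fun b hb => ?_⟩
    · rw [hcc]
      split_ifs with h
      · rw [h, h1]
      · simp
    · rw [hcc]
      split_ifs with h
      · rw [h, h2 b hb]
      · simp
  · rintro i j x ⟨h1, h2⟩ hx a ha
    have hxa := DGRing.mul_mem_gr rfl hx ha
    rcases lt_or_ge 0 i with hi | hi
    · simp [DGRing.eq_zero_of_pos hR hi hx]
    rcases lt_or_ge 0 j with hj | hj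
    · simp [DGRing.eq_zero_of_pos hR hj ha]
    refine ⟨?_, fun b hb => ?_⟩
    · by_cases hij : i + j = -1
      · rw [DGRing.comp_of_mem (hij ▸ hxa)]
        rcases (show i = 0 ∧ j = -1 ∨ i = -1 ∧ j = 0 by omega) with ⟨rfl, rfl⟩ | ⟨rfl, rfl⟩
        · have := h2 a ha
          rwa [DGRing.comp_of_mem hx] at this
        · rw [DGRing.comp_of_mem hx] at h1
          rw [op_mul, mul_smul, h1, smul_zero]
      · rw [DGRing.comp_of_mem_ne hxa hij, MulOpposite.op_zero, _root_.zero_smul]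
    · by_cases hij : i + j = 0
      · obtain ⟨rfl, rfl⟩ : i = 0 ∧ j = 0 := by omega
        rw [DGRing.comp_of_mem (by simpa using hxa), mul_assoc]
        have := h2 (a * b) (DGRing.mul_mem_gr (by norm_num) ha hb)
        rwa [DGRing.comp_of_mem hx] at this
      · rw [DGRing.comp_of_mem_ne hxa hij, zero_mul, MulOpposite.op_zero, _root_.zero_smul]
  · rintro i x ⟨h1, h2⟩ hx
    have hdx := R.d_mem hx
    refine ⟨?_, fun b hb => ?_⟩
    · by_cases hi : i = -2
      · subst hi
        rw [DGRing.comp_of_mem (by simpa using hdx)]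
        exact hw x hx
      · rw [DGRing.comp_of_mem_ne hdx (by omega), MulOpposite.op_zero, _root_.zero_smul]
    · by_cases hi : i = -1
      · subst hi
        rw [DGRing.comp_of_mem (by simpa using hdx)]
        rw [DGRing.comp_of_mem hx] at h1
        -- For `x` and `b` in `R⁻¹` one has `d(xb) = d(x)b - x d(b)`. The left side kills `w` since
        -- `xb ∈ R⁻²`, and so does `x d(b)` since `x` does.
        have h3 := hw _ (DGRing.mul_mem_gr (by norm_num) hx hb)
        rwa [R.leibniz hx, MulOpposite.op_add, add_smul, MulOpposite.op_smul, smul_assoc, op_mul x, mul_smul, h1,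
          smul_zero, smul_zero, add_zero] at h3
      · rw [DGRing.comp_of_mem_ne hdx (by omega), zero_mul, MulOpposite.op_zero, _root_.zero_smul]

section Existence

variable (hR : R.IsNonpositive) (hA : R.IsSkewCommutative) (hn : R.IsRightDGNoetherian)
  {p : Ideal (R.Zero)ᵐᵒᵖ} [hp : p.IsPrime]

include hA in
lemma exists_homogeneous_hasAnn {x : M.carrier} (hx : HasAnn p x) :
    ∃ i, HasAnn p (M.comp i x) := by
  obtain ⟨s, hs⟩ := M.sum_comp x
  have h1 : ∀ r ∈ p, r • x = 0 := fun r hr => (hx r).2 hr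
  have h2 : HasAnn p (∑ i ∈ s, M.comp i x) := hs ▸ hx
  obtain ⟨i, -, hi⟩ := h2.exists_of_sum (DGRing.zero_mul_comm hA) s _ fun i _ r hr => by
    rw [← comp_zero_smul, h1 r hr, map_zero]
  exact ⟨i, hi⟩

include hA hn in
-- The family indexed by the complement of `p` is directed: `s` and `t` are dominated by their
-- product, which stays outside `p`.
lemma exists_notMem_forall_le (K : (R.Zero)ᵐᵒᵖ → AddSubgroup R.carrier)
    (hK : ∀ s ∉ p, R.IsRightDGIdeal (K s)) (hmul : ∀ s t, K s ≤ K (t * s)) :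
    ∃ r ∉ p, ∀ s ∉ p, K s ≤ K r := by
  have : Nonempty {s // s ∉ p} := ⟨⟨1, p.one_notMem⟩⟩
  obtain ⟨⟨r, hr⟩, h⟩ := DGRing.exists_greatest_of_directed hn
    (fun s : {s // s ∉ p} => K s) (fun s => hK s s.2) fun s t =>
      ⟨⟨s.1 * t.1, fun h => (hp.mem_or_mem h).elim s.2 t.2⟩, by
        change K s ≤ K (s.1 * t.1)
        rw [DGRing.zero_mul_comm hA]
        exact hmul _ _, hmul _ _⟩
  exact ⟨r, hr, fun s hs => h ⟨s, hs⟩⟩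

include hR hA hn in
/-- If each homogeneous element of negative degree annihilates a multiple of `y`, then a common
multiple is annihilated by the negative part. -/
lemma exists_notMem_neg_smul {m : ℤ} {y : M.carrier} (hy : y ∈ M.gr m)
    (h : ∀ j < 0, ∀ a ∈ R.gr j, ∃ s ∉ p, op a • s • y = 0) :
    ∃ r ∉ p, ∀ j < 0, ∀ a ∈ R.gr j, op a • r • y = 0 := by
  have hcomm := DGRing.zero_mul_comm hA
  have hswap : ∀ (a : R.carrier) (s t : (R.Zero)ᵐᵒᵖ), op a • s • y = 0 →
      op a • (t * s) • y = 0 := fun a s t h => by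
    rw [mul_smul, op_smul_zero_smul hA, h, smul_zero]
  have hswap' : ∀ (a : R.carrier) (s t : (R.Zero)ᵐᵒᵖ), op a • s • y = 0 →
      op a • (s * t) • y = 0 := fun a s t h => by
    rw [hcomm]
    exact hswap a s t h
  -- The chain condition sees only dg ideals, so `a` must be treated together with `d(a)`. This
  -- works for degrees below `-1`; in degree `-1`, `d(a)` lies in `R⁰` and the assumption does not
  -- apply to it.
  obtain ⟨r, hr, hmax⟩ := exists_notMem_forall_le hA hn (p := p) (fun s => annWithD (s • y))
    (fun s _ => annWithD_isRightDGIdeal (zero_smul_mem hy s))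
    (fun s t a ha => ⟨hswap _ _ _ ha.1, hswap _ _ _ ha.2⟩)
  have h2 : ∀ j < -1, ∀ a ∈ R.gr j, op a • r • y = 0 ∧ op (R.d a) • r • y = 0 := by
    intro j hj a ha
    obtain ⟨s, hs, hsa⟩ := h j (by omega) a ha
    obtain ⟨t, ht, hta⟩ := h (j + 1) (by omega) _ (R.d_mem ha)
    exact hmax (s * t) (fun h => (hp.mem_or_mem h).elim hs ht)
      ⟨hswap' _ _ _ hsa, hswap _ _ _ hta⟩
  -- Second round, for degree `-1`: `d(R⁻²)` now kills the element, so `annNegOne` is a dg ideal.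
  obtain ⟨q, hq, hmax⟩ := exists_notMem_forall_le hA hn (p := p)
    (fun s => annNegOne ((s * r) • y))
    (fun s _ => annNegOne_isRightDGIdeal hR fun c hc =>
      hswap _ _ _ (h2 (-2) (by norm_num) c hc).2)
    (fun s t a ha => by
      rw [mul_assoc]
      exact ⟨hswap _ _ _ ha.1, fun b hb => hswap _ _ _ (ha.2 b hb)⟩)
  refine ⟨q * r, fun h => (hp.mem_or_mem h).elim hq hr, fun j hj a ha => ?_⟩
  by_cases hj1 : j = -1
  · subst hj1
    obtain ⟨s, hs, hsa⟩ := h (-1) (by norm_num) a ha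
    have h3 : a ∈ annNegOne ((s * r) • y) := by
      refine ⟨?_, fun b hb => ?_⟩
      · rw [DGRing.comp_of_mem ha]
        exact hswap' _ _ _ hsa
      · rw [DGRing.comp_of_mem_ne ha (by norm_num), zero_mul, MulOpposite.op_zero, _root_.zero_smul]
    have h4 := (hmax s hs h3).1
    rwa [DGRing.comp_of_mem ha] at h4
  · exact hswap _ _ _ (h2 j (by omega) a ha).1

include hR hA hn in
/-- Every associated prime of the underlying `R⁰`-module comes from a socle element `y`, such that
moreover `dy` is zero or has the same annihilator. -/
lemma exists_isSocleElement (hb : R.IsBounded) {x : M.carrier} (hx : HasAnn p x) :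
    ∃ (m : ℤ) (y : M.carrier), IsSocleElement p m y ∧ (M.d y = 0 ∨ HasAnn p (M.d y)) := by
  have hcomm := DGRing.zero_mul_comm hA
  obtain ⟨i, hi⟩ := exists_homogeneous_hasAnn hA hx
  set z := M.comp i x with hz
  have hzi : z ∈ M.gr i := M.comp_mem i x
  have hle : ∀ a : R.carrier, ∀ r ∈ p, r • op a • z = 0 := fun a r hr => by
    rw [← op_smul_zero_smul hA, (hi r).2 hr, smul_zero]
  -- Take the lowest degree in which a multiple `z·a` still has annihilator `p`. Multiplying further
  -- by `R^{<0}` must enlarge the annihilator, so each product is killed by some element outside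
  -- `p`.
  obtain ⟨j, ⟨a, haj, ha⟩, hmin⟩ : ∃ j, (∃ a ∈ R.gr j, HasAnn p (op a • z)) ∧
      ∀ k, (∃ a ∈ R.gr k, HasAnn p (op a • z)) → j ≤ k := by
    obtain ⟨B, hB⟩ := hb
    refine Int.exists_least_of_bdd ⟨-B, ?_⟩ ⟨0, 1, SetLike.GradedOne.one_mem, by simpa using hi⟩
    rintro k ⟨a, hak, ha⟩
    by_contra hk
    rw [hB k (by rw [lt_abs]; omega)] at hak
    obtain rfl : a = 0 := hak
    exact ha.ne_zero (by simp)
  obtain ⟨r, hr, hrneg⟩ := exists_notMem_neg_smul hR hA hn (p := p) (M.smul_mem hzi haj) (by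
    intro k hk b hbk
    by_contra! hcon
    have := hmin (j + k) ⟨a * b, SetLike.GradedMul.mul_mem haj hbk, fun s =>
      ⟨fun hs => by_contra fun hsp => hcon s hsp ?_, hle _ s⟩⟩
    · omega
    · rw [op_smul_zero_smul hA, ← mul_smul (op b), ← op_mul]
      exact hs)
  have hy : IsSocleElement p (i + j) (r • op a • z) :=
    ⟨zero_smul_mem (M.smul_mem hzi haj) r, ha.smul hcomm hr, hrneg⟩
  -- `p` kills the differential in any case. If something outside `p` does too, multiplying by it
  -- gives a cycle; otherwise the annihilator is exactly `p`.
  by_cases h : ∃ s ∉ p, s • M.d (r • op a • z) = 0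
  · obtain ⟨s, hs, hsy⟩ := h
    exact ⟨_, _, hy.zero_smul hA hs, Or.inl (by rw [d_zero_smul hR, hsy])⟩
  · push Not at h
    refine ⟨_, _, hy, Or.inr fun s => ⟨fun h0 => by_contra fun hs => h s hs h0, fun hs => ?_⟩⟩
    rw [← d_zero_smul hR, (hy.ann s).2 hs, map_zero]

end Existence

end DGMod

/-! ### Associated primes of modules -/

lemma ModuleCat.exists_mono_of_hasAnn {A : Type u} [Ring A] {X : ModuleCat.{u} A} {p : Ideal A}
    {x : X} (h : HasAnn p x) : ∃ f : ModuleCat.of A (A ⧸ p) ⟶ X, Mono f := by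
  have hp : p = LinearMap.ker (LinearMap.toSpanSingleton A X x) := by
    ext r
    simpa using (h r).symm
  refine ⟨ModuleCat.ofHom (Submodule.liftQ p (LinearMap.toSpanSingleton A X x) hp.le), ?_⟩
  rw [ModuleCat.mono_iff_injective]
  exact LinearMap.ker_eq_bot.1 (Submodule.ker_liftQ_eq_bot _ _ _ hp.ge)

lemma ModuleCat.exists_hasAnn_of_isMonoform {A : Type u} [Ring A] [IsNoetherianRing A]
    (hA : ∀ a b : A, a * b = b * a) {H : ModuleCat.{u} A} (hH : IsMonoform H) :
    ∃ p : Ideal A, p.IsPrime ∧ ∃ x : H, HasAnn p x := by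
  obtain ⟨x, hx⟩ := ModuleCat.exists_ne_zero_of_not_isZero hH.1
  obtain ⟨p, hp, r, hr⟩ := exists_hasAnn_of_ne_zero hA hx
  exact ⟨p, hp, _, hr⟩

namespace DGMod

variable {R : DGRing.{u}} (hR : R.IsNonpositive) (n : ℤ) (H : ModuleCat.{u} (R.Zero)ᵐᵒᵖ)

/-! ### The shifts of `D(H)` -/

/-- The shift `D(H)[n]`. -/
abbrev shiftD : DGMod R := shiftObj n (D hR H)

/-- The element of `D(H)[n]` with components `x` and `y`. -/
def shiftD.mk (x y : H) : (shiftD hR n H).carrier := ((x, y) : H × H)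

variable {hR n H}

lemma shiftD.exists_mk (q : (shiftD hR n H).carrier) : ∃ x y, q = shiftD.mk hR n H x y :=
  ⟨_, _, rfl⟩

lemma shiftD.mk_inj {x y x' y' : H} :
    shiftD.mk hR n H x y = shiftD.mk hR n H x' y' ↔ x = x' ∧ y = y' := Prod.mk_inj

lemma shiftD.mk_eq_zero {x y : H} : shiftD.mk hR n H x y = 0 ↔ x = 0 ∧ y = 0 := Prod.mk_eq_zero

lemma shiftD.mk_mem {x y : H} {i : ℤ} : shiftD.mk hR n H x y ∈ (shiftD hR n H).gr i ↔
    (i + n ≠ -1 → x = 0) ∧ (i + n ≠ 0 → y = 0) := Iff.rfl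

lemma shiftD.op_smul_mk (a : R.carrier) (x y : H) : op a • shiftD.mk hR n H x y =
    shiftD.mk hR n H (op (R.comp0 a) • x + op (R.dComp a) • y) (op (R.comp0 a) • y) := rfl

lemma shiftD.smul_mk (r : (R.Zero)ᵐᵒᵖ) (x y : H) :
    r • shiftD.mk hR n H x y = shiftD.mk hR n H (r • x) (r • y) := by
  have h0 : op (R.comp0 (r.unop : R.carrier)) = r :=
    unop_injective (Subtype.ext (DGRing.comp_of_mem r.unop.2))
  have h1 : op (R.dComp (r.unop : R.carrier)) • y = 0 := by
    rw [DGRing.dComp_of_mem_ne r.unop.2 (by norm_num)]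
    exact zero_smul (R.Zero)ᵐᵒᵖ y
  rw [zero_smul_eq, shiftD.op_smul_mk, h0, h1, add_zero]

lemma shiftD.zsmul_mk (k : ℤ) (x y : H) :
    k • shiftD.mk hR n H x y = shiftD.mk hR n H (k • x) (k • y) := rfl

lemma shiftD.d_mk (x y : H) :
    (shiftD hR n H).d (shiftD.mk hR n H x y) = shiftD.mk hR n H 0 ((n.negOnePow : ℤ) • x) := by
  change (n.negOnePow : ℤ) • shiftD.mk hR n H 0 x = _
  rw [shiftD.zsmul_mk, smul_zero]

lemma negOnePow_smul_eq_zero {X : Type*} [AddCommGroup X] (k : ℤ) (x : X) :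
    (k.negOnePow : ℤ) • x = 0 ↔ x = 0 := by
  rcases Int.units_eq_one_or k.negOnePow with h | h <;> simp [h]

variable {p : Ideal (R.Zero)ᵐᵒᵖ}

lemma shiftD.hasAnn_left {x : H} : HasAnn p (shiftD.mk hR n H x 0) ↔ HasAnn p x := by
  simp only [HasAnn, shiftD.smul_mk, shiftD.mk_eq_zero, smul_zero, and_true]

lemma shiftD.hasAnn_right {x : H} : HasAnn p (shiftD.mk hR n H 0 x) ↔ HasAnn p x := by
  simp only [HasAnn, shiftD.smul_mk, shiftD.mk_eq_zero, smul_zero, true_and]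

lemma shiftD.hasAnn_d {x y : H} (hx : HasAnn p x) :
    HasAnn p ((shiftD hR n H).d (shiftD.mk hR n H x y)) := by
  rw [shiftD.d_mk, shiftD.hasAnn_right]
  intro r
  rw [smul_comm, negOnePow_smul_eq_zero, hx]

lemma shiftD.isSocleElement_left {x : H} (hx : HasAnn p x) :
    IsSocleElement p (-1 - n) (shiftD.mk hR n H x 0) := by
  refine ⟨shiftD.mk_mem.2 ⟨fun h => absurd (by ring) h, fun _ => rfl⟩, shiftD.hasAnn_left.2 hx,
    fun j hj a ha => ?_⟩
  rw [shiftD.op_smul_mk, DGRing.comp0_of_mem_ne ha hj.ne, smul_zero, smul_zero, add_zero]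
  exact shiftD.mk_eq_zero.2 ⟨zero_smul (R.Zero)ᵐᵒᵖ x, rfl⟩

/-- An element `a` of degree `-1` sends `(0, x)` to `(x·d(a), 0)`, hence the condition on `d(R⁻¹)`.
By `IsSocleElement.dComp_mem` it holds as soon as some socle element for `p` is a cycle. -/
lemma shiftD.isSocleElement_right {x : H} (hx : HasAnn p x)
    (hp : ∀ a : R.carrier, op (R.dComp a) ∈ p) :
    IsSocleElement p (-n) (shiftD.mk hR n H 0 x) := by
  refine ⟨shiftD.mk_mem.2 ⟨fun _ => rfl, fun h => absurd (by ring) h⟩, shiftD.hasAnn_right.2 hx,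
    fun j hj a ha => ?_⟩
  rw [shiftD.op_smul_mk, DGRing.comp0_of_mem_ne ha hj.ne, smul_zero, zero_add]
  refine shiftD.mk_eq_zero.2 ⟨?_, zero_smul (R.Zero)ᵐᵒᵖ x⟩
  by_cases h : j = -1
  · subst h
    exact (hx _).2 (hp a)
  · rw [DGRing.dComp_of_mem_ne ha h]
    exact zero_smul (R.Zero)ᵐᵒᵖ x

lemma IsSocleElement.dComp_mem {M : DGMod R} (hR : R.IsNonpositive) {m : ℤ} {x : M.carrier}
    (hx : IsSocleElement p m x) (hd : M.d x = 0) (a : R.carrier) :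
    op (R.dComp a) ∈ p := by
  have h := hx.op_smul_d hR a
  rw [hd, smul_zero, smul_zero, zero_sub, eq_comm, neg_eq_zero, negOnePow_smul_eq_zero] at h
  exact (hx.ann _).1 h

/-- Socle elements detect the shifts of `D(H)`. -/
lemma IsSocleElement.haveCommon_shiftD [p.IsPrime] {M : DGMod R} {m : ℤ} {y : M.carrier}
    (hy : IsSocleElement p m y) {x : H} (hx : HasAnn p x)
    (hm : M.d y = 0 ∧ m = -n ∨ HasAnn p (M.d y) ∧ m = -1 - n) :
    HaveCommonNonzeroSubobject M (shiftD hR n H) := by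
  rcases hm with ⟨hd, rfl⟩ | ⟨hd, rfl⟩
  · refine hy.haveCommon hR
      (shiftD.isSocleElement_right hx fun a => hy.dComp_mem hR hd a) fun r => ?_
    have : shiftD.mk hR n H 0 0 = 0 := rfl
    rw [hd, shiftD.d_mk, smul_zero, smul_zero, this, smul_zero, eq_self_iff_true, eq_self_iff_true]
  · refine hy.haveCommon hR (shiftD.isSocleElement_left hx) fun r => ?_
    rw [hd, shiftD.hasAnn_d hx]

/-- The differential carries a nonzero first coordinate to the second factor up to sign, so every
nonzero dg submodule meets that factor. -/
lemma shiftD.exists_right {q : (shiftD hR n H).carrier} (hq : q ≠ 0) :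
    ∃ x : H, x ≠ 0 ∧ (q = shiftD.mk hR n H 0 x ∨ (shiftD hR n H).d q = shiftD.mk hR n H 0 x) := by
  obtain ⟨x, y, rfl⟩ := shiftD.exists_mk q
  by_cases hx : x = 0
  · subst hx
    exact ⟨y, fun hy => hq (shiftD.mk_eq_zero.2 ⟨rfl, hy⟩), Or.inl rfl⟩
  · exact ⟨_, fun h => hx ((negOnePow_smul_eq_zero n x).1 h), Or.inr (shiftD.d_mk x y)⟩

lemma shiftD.exists_hasAnn (hA : R.IsSkewCommutative) [p.IsPrime] {q : (shiftD hR n H).carrier}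
    (hq : HasAnn p q) : ∃ x : H, HasAnn p x := by
  obtain ⟨i, hi⟩ := exists_homogeneous_hasAnn hA hq
  have hmem := (shiftD hR n H).comp_mem i q
  obtain ⟨x, y, h⟩ := shiftD.exists_mk ((shiftD hR n H).comp i q)
  rw [h] at hi hmem
  rw [shiftD.mk_mem] at hmem
  by_cases hin : i + n = -1
  · obtain rfl := hmem.2 (by omega)
    exact ⟨x, shiftD.hasAnn_left.1 hi⟩
  · obtain rfl := hmem.1 hin
    exact ⟨y, shiftD.hasAnn_right.1 hi⟩

/-- Everything can be read off in degree `-n`, where `D(H)[n]` is `H`: a common subobject of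
`D(H)[n]` and its quotient by `L` yields `Ann(x) = (L₀ : y)` in `H`, with `L₀ ≠ 0` the part of `L`
in that degree. -/
lemma isMonoform_shiftD (hH : IsMonoform H) : IsMonoform (shiftD hR n H) := by
  obtain ⟨x₀, hx₀⟩ := ModuleCat.exists_ne_zero_of_not_isZero hH.1
  refine isMonoform_of_not_common (m := shiftD.mk hR n H 0 x₀)
    (fun h => hx₀ (shiftD.mk_eq_zero.1 h).2) fun L l hl hl0 => ?_
  rintro ⟨Z, hZ, ⟨f, hf⟩, ⟨g, hg⟩⟩
  rw [mono_iff_injective] at hf hg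
  obtain ⟨z, hz⟩ := not_isZero_iff.1 hZ
  obtain ⟨x, hx, w, hw⟩ : ∃ x : H, x ≠ 0 ∧ ∃ w, f.toLin w = shiftD.mk hR n H 0 x := by
    obtain ⟨x, hx, h | h⟩ := shiftD.exists_right ((map_ne_zero_iff _ hf).2 hz)
    · exact ⟨x, hx, z, h⟩
    · exact ⟨x, hx, Z.d z, by rw [f.map_d, h]⟩
  have hwm : w ∈ Z.gr (-n) := mem_gr_of_map f hf (by
    rw [hw]
    exact shiftD.mk_mem.2 ⟨fun _ => rfl, fun h => absurd (by ring) h⟩)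
  obtain ⟨q, hq, hqw⟩ := g.map_mem hwm
  obtain ⟨x', y, rfl⟩ := shiftD.exists_mk q
  obtain rfl : x' = 0 := (shiftD.mk_mem.1 hq).1 (by omega)
  let L₀ : Submodule (R.Zero)ᵐᵒᵖ H :=
    { carrier := {h | shiftD.mk hR n H 0 h ∈ L.toSub}
      zero_mem' := L.toSub.zero_mem
      add_mem' := fun {a b} ha hb => by
        have : shiftD.mk hR n H 0 (a + b) = shiftD.mk hR n H 0 a + shiftD.mk hR n H 0 b :=
          shiftD.mk_inj.2 ⟨(add_zero 0).symm, rfl⟩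
        exact (congrArg (· ∈ L.toSub) this).mpr (L.toSub.add_mem ha hb)
      smul_mem' := fun r a ha => by
        have h := shiftD.smul_mk (hR := hR) (n := n) r (0 : H) a
        rw [smul_zero] at h
        exact (congrArg (· ∈ L.toSub) h).mp (L.toSub.smul_mem (op (r.unop : R.carrier)) ha) }
  have hL₀ : L₀ ≠ ⊥ := by
    obtain ⟨y, hy, h | h⟩ := shiftD.exists_right hl0
    · exact (Submodule.ne_bot_iff _).2 ⟨y, show shiftD.mk hR n H 0 y ∈ L.toSub from h ▸ hl, hy⟩
    · exact (Submodule.ne_bot_iff _).2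
        ⟨y, show shiftD.mk hR n H 0 y ∈ L.toSub from h ▸ L.d_mem l hl, hy⟩
  refine ModuleCat.not_ann_of_isMonoform hH hL₀ hx y fun r => ?_
  have h1 : r • x = 0 ↔ r • w = 0 := by
    rw [← map_eq_zero_iff f.toZeroLin hf, map_smul, Hom.toZeroLin_apply, hw, shiftD.smul_mk,
      shiftD.mk_eq_zero, smul_zero]
    exact (and_iff_right rfl).symm
  have h2 : g.toLin w = L.proj.toLin (shiftD.mk hR n H 0 y) := hqw.symm
  rw [h1, ← map_eq_zero_iff g.toZeroLin hg, map_smul, Hom.toZeroLin_apply, h2,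
    ← Hom.toZeroLin_apply, ← map_smul, Hom.toZeroLin_apply, L.proj_eq_zero, shiftD.smul_mk,
    smul_zero]
  rfl

lemma isMonoform_D (hH : IsMonoform H) : IsMonoform (D hR H) := by
  obtain ⟨x₀, hx₀⟩ := ModuleCat.exists_ne_zero_of_not_isZero hH.1
  exact isMonoform_of_mono (isMonoform_shiftD (n := 0) hH) (shiftZero (D hR H)).inv
    (not_isZero_iff.2 ⟨shiftD.mk hR 0 H 0 x₀, fun h => hx₀ (shiftD.mk_eq_zero.1 h).2⟩)

/-! ### The atoms of dg modules -/

lemma toOrbit_shiftD (hH : IsMonoform H) :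
    (AtomSpectrum.mk (shiftD hR n H) (isMonoform_shiftD hH)).toOrbit =
      (AtomSpectrum.mk (D hR H) (isMonoform_D hH)).toOrbit :=
  (Quot.sound ⟨D hR H, isMonoform_D hH, n, isMonoform_shiftD hH, rfl, rfl⟩).symm

lemma exists_hasAnn_of_not_isZero (hA : R.IsSkewCommutative) (hn : R.IsRightDGNoetherian)
    {M : DGMod R} (hM : ¬ IsZero M) (hR : R.IsNonpositive) :
    ∃ p : Ideal (R.Zero)ᵐᵒᵖ, p.IsPrime ∧ ∃ x : M.carrier, HasAnn p x := by
  have := DGRing.isNoetherianRing_zero hR hn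
  obtain ⟨x, hx⟩ := not_isZero_iff.1 hM
  obtain ⟨p, hp, r, hr⟩ := exists_hasAnn_of_ne_zero (DGRing.zero_mul_comm hA) hx
  exact ⟨p, hp, _, hr⟩

section

variable (hR) (hb : R.IsBounded) (hA : R.IsSkewCommutative) (hn : R.IsRightDGNoetherian)
include hR hb hA hn

lemma exists_haveCommon_shiftD [p.IsPrime] {M : DGMod R} {y : M.carrier} (hy : HasAnn p y)
    {x : H} (hx : HasAnn p x) : ∃ n, HaveCommonNonzeroSubobject M (shiftD hR n H) := by
  obtain ⟨m, z, hz, hd | hd⟩ := exists_isSocleElement hR hA hn hb hy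
  · exact ⟨-m, hz.haveCommon_shiftD hx (Or.inl ⟨hd, by ring⟩)⟩
  · exact ⟨-1 - m, hz.haveCommon_shiftD hx (Or.inr ⟨hd, by ring⟩)⟩

lemma toOrbit_eq [p.IsPrime] {M : DGMod R} (hM : IsMonoform M) {y : M.carrier} (hy : HasAnn p y)
    (hH : IsMonoform H) {x : H} (hx : HasAnn p x) :
    (AtomSpectrum.mk M hM).toOrbit = (AtomSpectrum.mk (D hR H) (isMonoform_D hH)).toOrbit := by
  obtain ⟨n, h⟩ := exists_haveCommon_shiftD hR hb hA hn hy hx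
  rw [← toOrbit_shiftD (n := n) hH, (atom_eq_iff hM (isMonoform_shiftD hH)).2 h]

/-- `M` need not be monoform: the common subobject inherits monoformity from `D(H)[n]` and
represents its atom. -/
lemma toOrbit_mem_orbitAss [p.IsPrime] {M : DGMod R} {y : M.carrier} (hy : HasAnn p y)
    (hH : IsMonoform H) {x : H} (hx : HasAnn p x) :
    (AtomSpectrum.mk (D hR H) (isMonoform_D hH)).toOrbit ∈ orbitAss M := by
  obtain ⟨n, Z, hZ, ⟨f, hf⟩, ⟨g, hg⟩⟩ := exists_haveCommon_shiftD hR hb hA hn hy hx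
  have hZm : IsMonoform Z := isMonoform_of_mono (isMonoform_shiftD hH) g hZ
  refine ⟨AtomSpectrum.mk Z hZm, ⟨Z, hZm, rfl, f, hf⟩, ?_⟩
  rw [← toOrbit_shiftD (n := n) hH]
  congr 1
  exact (atom_eq_iff _ _).2 ⟨Z, hZ, ⟨𝟙 Z, inferInstance⟩, ⟨g, hg⟩⟩

/-- `M` shares subobjects with shifts of `D(R⁰/p)` and of `D(R⁰/q)`, whose only associated primes
are `p` and `q`. By uniformity of `M` these two share a nonzero subobject, and any associated prime
of it equals both. -/
lemma hasAnn_unique {M : DGMod R} (hM : IsMonoform M) {q : Ideal (R.Zero)ᵐᵒᵖ} [p.IsPrime]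
    [q.IsPrime] {x y : M.carrier} (hx : HasAnn p x) (hy : HasAnn q y) : p = q := by
  have hcomm := DGRing.zero_mul_comm hA
  have h1 : ∀ (q : Ideal (R.Zero)ᵐᵒᵖ) [q.IsPrime], ∀ y : M.carrier, HasAnn q y →
      ∃ n, HaveCommonNonzeroSubobject M (shiftD hR n (ModuleCat.of _ ((R.Zero)ᵐᵒᵖ ⧸ q))) :=
    fun q hq y hy => exists_haveCommon_shiftD hR hb hA hn hy
      (H := ModuleCat.of _ ((R.Zero)ᵐᵒᵖ ⧸ q)) (ModuleCat.hasAnn_mk hcomm q.one_notMem)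
  have h2 : ∀ (q : Ideal (R.Zero)ᵐᵒᵖ) [q.IsPrime], ∀ n (p : Ideal (R.Zero)ᵐᵒᵖ) [p.IsPrime],
      ∀ z : (shiftD hR n (ModuleCat.of _ ((R.Zero)ᵐᵒᵖ ⧸ q))).carrier, HasAnn p z → p = q := by
    intro q _ n p _ z hz
    obtain ⟨x, hx⟩ := shiftD.exists_hasAnn hA hz
    exact hx.eq (ModuleCat.hasAnn_of_quotient hcomm hx.ne_zero)
  obtain ⟨n, hpn⟩ := h1 p x hx
  obtain ⟨m, hqm⟩ := h1 q y hy
  obtain ⟨Z, hZ, ⟨f, hf⟩, ⟨g, hg⟩⟩ :=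
    haveCommon_trans hM (M := shiftD hR n _) (by
      obtain ⟨Z, hZ, f, g⟩ := hpn
      exact ⟨Z, hZ, g, f⟩) hqm
  rw [mono_iff_injective] at hf hg
  obtain ⟨p₀, hp₀, z, hz⟩ := exists_hasAnn_of_not_isZero hA hn hZ hR
  rw [← h2 p n p₀ _ (hz.map f.toZeroLin hf), ← h2 q m p₀ _ (hz.map g.toZeroLin hg)]

end

/-! ### Comparison of the two atom spectra -/

/-- The prime ideals of `R⁰` that are annihilators of elements. -/
def assPrimes (M : DGMod R) : Set (Ideal (R.Zero)ᵐᵒᵖ) :=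
  {p | p.IsPrime ∧ ∃ x : M.carrier, HasAnn p x}

section

variable (hR) (hb : R.IsBounded) (hA : R.IsSkewCommutative) (hn : R.IsRightDGNoetherian)

include hR hb hA hn in
lemma assPrimes_eq_of_haveCommon {M N : DGMod R} (hM : IsMonoform M) (hN : IsMonoform N)
    (h : HaveCommonNonzeroSubobject M N) : assPrimes M = assPrimes N := by
  obtain ⟨Z, hZ, ⟨f, hf⟩, ⟨g, hg⟩⟩ := h
  rw [mono_iff_injective] at hf hg
  obtain ⟨p, hp, z, hz⟩ := exists_hasAnn_of_not_isZero hA hn hZ hR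
  have key : ∀ {X : DGMod R}, IsMonoform X → ∀ x : X.carrier, HasAnn p x → assPrimes X = {p} := by
    refine fun {X} hX x hx => Set.eq_singleton_iff_unique_mem.2 ⟨⟨hp, x, hx⟩, ?_⟩
    rintro q ⟨hq, y, hy⟩
    exact hasAnn_unique hR hb hA hn hX hy hx
  rw [key hM _ (hz.map f.toZeroLin hf), key hN _ (hz.map g.toZeroLin hg)]

/-- The associated primes of a point of the orbit atom spectrum. -/
def orbitAssPrimes : OrbitAtomSpectrum (DGMod R) → Set (Ideal (R.Zero)ᵐᵒᵖ) :=
  Quot.lift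
    (Quot.lift (fun X : {X : DGMod R // IsMonoform X} => assPrimes X.1)
      fun X Y h => assPrimes_eq_of_haveCommon hR hb hA hn X.2 Y.2 h)
    (by
      -- A shift changes neither the underlying group nor the right action.
      rintro _ _ ⟨X, hX, n, hX', rfl, rfl⟩
      rfl)

/-- The map from the atom spectrum of `R⁰` to the orbit atom spectrum induced by `D`. -/
def atomToOrbit : AtomSpectrum (ModuleCat.{u} (R.Zero)ᵐᵒᵖ) → OrbitAtomSpectrum (DGMod R) :=
  Quot.lift (fun H => (AtomSpectrum.mk (D hR H.1) (isMonoform_D H.2)).toOrbit) (by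
    rintro ⟨H, hH⟩ ⟨K, hK⟩ h
    obtain ⟨Z, f, g, z, hf, hg, hz⟩ := ModuleCat.exists_ne_zero_of_haveCommon h
    have := DGRing.isNoetherianRing_zero hR hn
    obtain ⟨p, hp, r, hr⟩ := exists_hasAnn_of_ne_zero (DGRing.zero_mul_comm hA) hz
    rw [← toOrbit_shiftD (n := 0) hH]
    exact toOrbit_eq hR hb hA hn (isMonoform_shiftD hH) (shiftD.hasAnn_right.2 (hr.map f hf)) hK
      (hr.map g hg))

lemma atomToOrbit_mk (hH : IsMonoform H) : atomToOrbit hR hb hA hn (AtomSpectrum.mk H hH) =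
    (AtomSpectrum.mk (D hR H) (isMonoform_D hH)).toOrbit := rfl

lemma orbitAssPrimes_atomToOrbit (hH : IsMonoform H) :
    orbitAssPrimes hR hb hA hn (atomToOrbit hR hb hA hn (AtomSpectrum.mk H hH)) =
      {p | p.IsPrime ∧ ∃ x : H, HasAnn p x} := by
  rw [atomToOrbit_mk, ← toOrbit_shiftD (n := 0) hH]
  ext p
  refine ⟨fun ⟨hp, x, hx⟩ => ⟨hp, shiftD.exists_hasAnn (n := 0) hA hx⟩, fun ⟨hp, x, hx⟩ =>
    ⟨hp, shiftD.mk hR 0 H 0 x, shiftD.hasAnn_right.2 hx⟩⟩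

/-- The orbit of `D(H)` remembers the associated primes of `H`; modules that share one contain a
common cyclic submodule. -/
lemma atomToOrbit_injective : Function.Injective (atomToOrbit hR hb hA hn) := by
  rintro ⟨H, hH⟩ ⟨K, hK⟩ h
  have := DGRing.isNoetherianRing_zero hR hn
  obtain ⟨p, hp, x, hx⟩ := ModuleCat.exists_hasAnn_of_isMonoform (DGRing.zero_mul_comm hA) hH
  have h1 := orbitAssPrimes_atomToOrbit hR hb hA hn hH
  have h2 := orbitAssPrimes_atomToOrbit hR hb hA hn hK
  have h3 : p ∈ {p : Ideal (R.Zero)ᵐᵒᵖ | p.IsPrime ∧ ∃ x : K, HasAnn p x} := by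
    rw [← h2]
    refine (congrArg (fun o => p ∈ orbitAssPrimes hR hb hA hn o) h).mp ?_
    exact h1.symm ▸ ⟨hp, x, hx⟩
  obtain ⟨-, y, hy⟩ := h3
  exact Quot.sound (ModuleCat.haveCommon_of_ann hx.ne_zero fun r => (hx r).trans (hy r).symm)

lemma atomToOrbit_surjective : Function.Surjective (atomToOrbit hR hb hA hn) := by
  rintro ⟨⟨X, hX⟩⟩
  obtain ⟨p, hp, x, hx⟩ := exists_hasAnn_of_not_isZero hA hn hX.1 hR
  have hcomm := DGRing.zero_mul_comm hA
  exact ⟨AtomSpectrum.mk _ (ModuleCat.isMonoform_quotient hcomm p),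
    (toOrbit_eq hR hb hA hn hX hx (ModuleCat.isMonoform_quotient hcomm p)
      (ModuleCat.hasAnn_mk hcomm p.one_notMem)).symm⟩

/-- Both sides are translated into primes that are annihilators of elements of `M`, a notion that
involves neither the grading nor the differential. -/
lemma orbitAss_eq (M : DGMod R) :
    orbitAss M = atomToOrbit hR hb hA hn '' atomAss M.toZeroModule := by
  have hcomm := DGRing.zero_mul_comm hA
  ext α
  constructor
  · rintro ⟨_, ⟨X, hX, rfl, f, hf⟩, rfl⟩
    rw [mono_iff_injective] at hf
    obtain ⟨p, hp, x, hx⟩ := exists_hasAnn_of_not_isZero hA hn hX.1 hR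
    have hm := ModuleCat.isMonoform_quotient hcomm p
    have hfx : HasAnn p (M := M.toZeroModule) (f.toLin x) := hx.map f.toZeroLin hf
    exact ⟨AtomSpectrum.mk _ hm, ⟨_, hm, rfl, ModuleCat.exists_mono_of_hasAnn hfx⟩,
      (toOrbit_eq hR hb hA hn hX hx hm (ModuleCat.hasAnn_mk hcomm p.one_notMem)).symm⟩
  · rintro ⟨_, ⟨H, hH, rfl, f, hf⟩, rfl⟩
    rw [ModuleCat.mono_iff_injective] at hf
    have := DGRing.isNoetherianRing_zero hR hn
    obtain ⟨p, hp, x, hx⟩ := ModuleCat.exists_hasAnn_of_isMonoform hcomm hH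
    exact toOrbit_mem_orbitAss hR hb hA hn (M := M) (hx.map f.hom hf) hH hx

end

/-! ### Specialization -/

section Specialization

/-- For a socle element `w`, the dg submodule of the elements `wr + d(w)s` with `r` and `s` in the
ideal `q`. -/
def socleMul (hR : R.IsNonpositive) (hA : R.IsSkewCommutative) {M : DGMod R} {m : ℤ}
    {w : M.carrier} (hw : IsSocleElement p m w) (q : Ideal (R.Zero)ᵐᵒᵖ) : DGSub M where
  toSub :=
    { carrier := {z | ∃ r ∈ q, ∃ s ∈ q, z = r • w + s • M.d w}
      zero_mem' := ⟨0, q.zero_mem, 0, q.zero_mem, by simp [zero_smul_zero]⟩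
      add_mem' := by
        rintro _ _ ⟨r, hr, s, hs, rfl⟩ ⟨r', hr', s', hs', rfl⟩
        exact ⟨r + r', q.add_mem hr hr', s + s', q.add_mem hs hs', by rw [add_smul, add_smul]; abel⟩
      smul_mem' := by
        rintro a _ ⟨r, hr, s, hs, rfl⟩
        have hcomm := DGRing.zero_mul_comm hA
        -- The coefficients come from `op_smul` and `op_smul_d`; the sign term is the contribution
        -- of `dw·a` to the degree of `w`.
        refine ⟨op (R.comp0 a.unop) * r - (m.negOnePow : ℤ) • (op (R.dComp a.unop) * s),
          q.sub_mem (q.mul_mem_left _ hr) (zsmul_mem (q.mul_mem_left _ hs) _),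
          op (R.comp0 a.unop) * s, q.mul_mem_left _ hs, ?_⟩
        rw [← op_unop a, smul_add, op_smul_zero_smul hA, op_smul_zero_smul hA, hw.op_smul hR,
          hw.op_smul_d hR, smul_sub, sub_smul, smul_assoc, smul_comm s (m.negOnePow : ℤ),
          smul_smul, smul_smul, smul_smul, hcomm r, hcomm s, hcomm s]
        simp only [unop_op, mul_smul]
        abel }
  comp_mem := by
    rintro i _ ⟨r, hr, s, hs, rfl⟩
    rw [map_add, comp_zero_smul, comp_zero_smul]
    by_cases h : m = i
    · subst h
      rw [comp_of_mem hw.mem, comp_of_mem_ne (M.d_mem hw.mem) (by omega)]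
      exact ⟨r, hr, 0, q.zero_mem, by simp [zero_smul_zero]⟩
    · rw [comp_of_mem_ne hw.mem h]
      by_cases h' : m + 1 = i
      · subst h'
        rw [comp_of_mem (M.d_mem hw.mem)]
        exact ⟨0, q.zero_mem, s, hs, by simp [zero_smul_zero]⟩
      · rw [comp_of_mem_ne (M.d_mem hw.mem) h']
        exact ⟨0, q.zero_mem, 0, q.zero_mem, by simp [zero_smul_zero]⟩
  d_mem := by
    rintro _ ⟨r, hr, s, hs, rfl⟩
    rw [map_add, d_zero_smul hR, d_zero_smul hR, M.d_d]
    exact ⟨0, q.zero_mem, r, hr, by simp [zero_smul_zero]⟩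

lemma mem_socleMul (hR : R.IsNonpositive) (hA : R.IsSkewCommutative) {M : DGMod R} {m : ℤ}
    {w : M.carrier} (hw : IsSocleElement p m w) (q : Ideal (R.Zero)ᵐᵒᵖ) (z : M.carrier) :
    z ∈ (socleMul hR hA hw q).toSub ↔ ∃ r ∈ q, ∃ s ∈ q, z = r • w + s • M.d w := Iff.rfl

lemma proj_zero_smul_eq_zero {M : DGMod R} (L : DGSub M) (r : (R.Zero)ᵐᵒᵖ) (z : M.carrier) :
    r • L.proj.toLin z = 0 ↔ r • z ∈ L.toSub := by
  rw [← L.proj_eq_zero, ← Hom.toZeroLin_apply, ← Hom.toZeroLin_apply, map_smul]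

variable {q : Ideal (R.Zero)ᵐᵒᵖ} {M : DGMod R} {m : ℤ} {w : M.carrier}

/-- In degree `m` the submodule is `q·w`, so a multiple `r·w` dies in the quotient exactly when `r ∈
p + q = q`. -/
lemma isSocleElement_proj_socleMul (hR : R.IsNonpositive) (hA : R.IsSkewCommutative)
    (hw : IsSocleElement p m w) (hpq : p ≤ q) :
    IsSocleElement q m ((socleMul hR hA hw q).proj.toLin w) := by
  refine ⟨Hom.map_mem _ hw.mem, fun r => ?_, fun j hj a ha => ?_⟩
  · rw [proj_zero_smul_eq_zero, mem_socleMul]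
    refine ⟨?_, fun hr => ⟨r, hr, 0, q.zero_mem, by simp [zero_smul_zero]⟩⟩
    rintro ⟨r', hr', s', -, h⟩
    have h1 := congrArg (M.comp m) h
    rw [map_add, comp_of_mem (zero_smul_mem hw.mem _), comp_of_mem (zero_smul_mem hw.mem _),
      comp_of_mem_ne (zero_smul_mem (M.d_mem hw.mem) _) (by omega), add_zero, ← sub_eq_zero,
      ← sub_smul, hw.ann] at h1
    simpa using q.add_mem (hpq h1) hr'
  · rw [← map_smul, hw.neg_smul j hj a ha, map_zero]

lemma hasAnn_d_proj_socleMul (hR : R.IsNonpositive) (hA : R.IsSkewCommutative)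
    (hw : IsSocleElement p m w) (hd : HasAnn p (M.d w)) (hpq : p ≤ q) :
    HasAnn q ((socleMul hR hA hw q).quot.d ((socleMul hR hA hw q).proj.toLin w)) := by
  intro r
  rw [← Hom.map_d, proj_zero_smul_eq_zero, mem_socleMul]
  refine ⟨?_, fun hr => ⟨0, q.zero_mem, r, hr, by simp [zero_smul_zero]⟩⟩
  rintro ⟨r', -, s', hs', h⟩
  have h1 := congrArg (M.comp (m + 1)) h
  have hdm := M.d_mem hw.mem
  rw [map_add, comp_of_mem (zero_smul_mem hdm _), comp_of_mem (zero_smul_mem hdm _),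
    comp_of_mem_ne (zero_smul_mem hw.mem _) (by omega), zero_add, ← sub_eq_zero,
    ← sub_smul, hd] at h1
  simpa using q.add_mem (hpq h1) hs'

/-- The dg module `D(R⁰ / p)`. -/
abbrev DPrime (hR : R.IsNonpositive) (p : Ideal (R.Zero)ᵐᵒᵖ) : DGMod R :=
  D hR (ModuleCat.of _ ((R.Zero)ᵐᵒᵖ ⧸ p))

lemma isMonoform_DPrime (hR : R.IsNonpositive) (hA : R.IsSkewCommutative)
    (p : Ideal (R.Zero)ᵐᵒᵖ) [p.IsPrime] : IsMonoform (DPrime hR p) :=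
  isMonoform_D (ModuleCat.isMonoform_quotient (DGRing.zero_mul_comm hA) p)

/-- A socle element for `p` in a quotient `Q` of `N` becomes one for `q` modulo `socleMul`, and its
differential remains zero or acquires annihilator `q`. Hence a further quotient of `N` contains a
nonzero subobject of `D(R⁰/q)`. -/
lemma mem_atomSupp_of_le (hR : R.IsNonpositive) (hb : R.IsBounded) (hA : R.IsSkewCommutative)
    (hn : R.IsRightDGNoetherian) [p.IsPrime] [q.IsPrime] (hpq : p ≤ q) (N : DGMod R)
    (hN : AtomSpectrum.mk _ (isMonoform_DPrime hR hA p) ∈ atomSupp N) :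
    AtomSpectrum.mk _ (isMonoform_DPrime hR hA q) ∈ atomSupp N := by
  have hcomm := DGRing.zero_mul_comm hA
  obtain ⟨H, hH, heq, Q, π, i, hπ, hi⟩ := hN
  rw [atom_eq_iff] at heq
  obtain ⟨Z, hZ, ⟨f, hf⟩, ⟨g, hg⟩⟩ := heq.of_mono (shiftZero _).inv i
  rw [mono_iff_injective] at hf hg
  obtain ⟨p₀, hp₀, z₀, hz₀⟩ := exists_hasAnn_of_not_isZero hA hn hZ hR
  obtain rfl : p₀ = p := by
    obtain ⟨x, hx⟩ := shiftD.exists_hasAnn hA (hz₀.map f.toZeroLin hf)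
    exact hx.eq (ModuleCat.hasAnn_of_quotient hcomm hx.ne_zero)
  obtain ⟨m, z, hz, hd⟩ := exists_isSocleElement hR hA hn hb hz₀
  -- The claim concerns atoms rather than orbits, so the shift must be exactly `0`. The embedding in
  -- `D(R⁰/p)` fixes the degree: cycles lie in degree `0`, elements with nonzero differential in
  -- degree `-1`.
  have hm : Z.d z = 0 ∧ m = -0 ∨ HasAnn p₀ (Z.d z) ∧ m = -1 - 0 := by
    have hfz := f.map_mem hz.mem
    have hfz0 := (hz.map f hf).ann.ne_zero
    have hfd := f.map_d z
    obtain ⟨x, y, hxy⟩ := shiftD.exists_mk (f.toLin z)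
    rw [hxy] at hfz hfz0 hfd
    rw [shiftD.mk_mem] at hfz
    rw [shiftD.d_mk] at hfd
    refine hd.imp (fun h => ⟨h, ?_⟩) (fun h => ⟨h, ?_⟩)
    · rw [h, map_zero, eq_comm, shiftD.mk_eq_zero, negOnePow_smul_eq_zero] at hfd
      obtain ⟨-, rfl⟩ := hfd
      by_contra hm
      exact hfz0 (shiftD.mk_eq_zero.2 ⟨rfl, hfz.2 (by simpa using hm)⟩)
    · by_contra hm
      obtain rfl := hfz.1 (by simpa using hm)
      rw [smul_zero, shiftD.mk_eq_zero.2 ⟨rfl, rfl⟩, map_eq_zero_iff _ hf] at hfd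
      exact h.ne_zero hfd
  have hw := hz.map g hg
  let L := socleMul hR hA hw q
  have hL : HaveCommonNonzeroSubobject L.quot
      (shiftD hR 0 (ModuleCat.of _ ((R.Zero)ᵐᵒᵖ ⧸ q))) := by
    refine (isSocleElement_proj_socleMul hR hA hw hpq).haveCommon_shiftD
      (ModuleCat.hasAnn_mk hcomm q.one_notMem) (hm.imp (fun h => And.intro ?_ h.2) (fun h => And.intro ?_ h.2))
    · rw [← Hom.map_d, ← Hom.map_d, h.1, map_zero, map_zero]
    · exact hasAnn_d_proj_socleMul hR hA hw (by
        rw [← g.map_d]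
        exact h.1.map g.toZeroLin hg) hpq
  obtain ⟨W, hW, ⟨a, ha⟩, ⟨b, hb⟩⟩ := hL.of_mono (𝟙 _) (shiftZero _).hom
  have hWm := isMonoform_of_mono (isMonoform_DPrime hR hA q) b hW
  have : Epi L.proj := epi_of_surjective _ L.proj_surjective
  exact ⟨W, hWm, (atom_eq_iff _ _).2 ⟨W, hW, ⟨b, hb⟩, ⟨𝟙 W, inferInstance⟩⟩, L.quot, π ≫ L.proj, a,
    epi_comp _ _, ha⟩

lemma specializes_of_le (hR : R.IsNonpositive) (hb : R.IsBounded) (hA : R.IsSkewCommutative)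
    (hn : R.IsRightDGNoetherian) [p.IsPrime] [q.IsPrime] (hpq : p ≤ q) :
    AtomSpectrum.mk _ (isMonoform_DPrime hR hA q) ⤳
      AtomSpectrum.mk _ (isMonoform_DPrime hR hA p) := by
  unfold Specializes
  rw [TopologicalSpace.nhds_generateFrom (a := AtomSpectrum.mk _ (isMonoform_DPrime hR hA p))]
  refine le_iInf₂ fun s hs => Filter.le_principal_iff.2 ?_
  obtain ⟨hps, N, rfl⟩ := hs
  have ho : IsOpen (atomSupp N) := TopologicalSpace.isOpen_generateFrom_of_mem ⟨N, rfl⟩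
  exact ho.mem_nhds (mem_atomSupp_of_le hR hb hA hn hpq N hps)

lemma suppSpecializesFromAss (hR : R.IsNonpositive) (hb : R.IsBounded) (hA : R.IsSkewCommutative)
    (hn : R.IsRightDGNoetherian) : SuppSpecializesFromAss (DGMod R) := by
  have hcomm := DGRing.zero_mul_comm hA
  have := DGRing.isNoetherianRing_zero hR hn
  rintro M _ ⟨_, ⟨H, hH, rfl, Q, π, i, hπ, hi⟩, rfl⟩
  rw [mono_iff_injective] at hi
  obtain ⟨q, hq, x, hx⟩ := exists_hasAnn_of_not_isZero hA hn hH.1 hR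
  obtain ⟨y, hy⟩ := surjective_of_epi π (i.toLin x)
  -- No element outside `q` kills the lift `y`, since its image in the quotient has annihilator `q`.
  obtain ⟨p, hp, hpq, r, hr⟩ := exists_hasAnn_smul hcomm q.primeCompl y fun s hs h => hs <| by
    rw [SetLike.mem_coe, ← hx.map i.toZeroLin hi, Hom.toZeroLin_apply, ← hy,
      ← Hom.toZeroLin_apply, ← map_smul, h, map_zero]
  have hle : p ≤ q := fun s hs => by_contra fun hsq => hpq s hsq hs
  refine ⟨_, toOrbit_mem_orbitAss hR hb hA hn hr (ModuleCat.isMonoform_quotient hcomm p)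
    (ModuleCat.hasAnn_mk hcomm p.one_notMem), ?_⟩
  rw [toOrbit_eq hR hb hA hn hH hx (ModuleCat.isMonoform_quotient hcomm q)
    (ModuleCat.hasAnn_mk hcomm q.one_notMem), ← specializes_iff_mem_closure]
  exact (specializes_of_le hR hb hA hn hle).map continuous_coinduced_rng

end Specialization

end DGMod

end

theorem mainTheorem5 (R : DGRing.{u}) (hbdd : R.IsBounded) (hpos : R.IsNonpositive)
    (hcomm : R.IsSkewCommutative) (hnoeth : R.IsDGNoetherian) :
    (∃ e : AtomSpectrum (ModuleCat.{u} (R.Zero)ᵐᵒᵖ) ≃ OrbitAtomSpectrum (DGMod R),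
      (∀ (H : ModuleCat.{u} (R.Zero)ᵐᵒᵖ) (hH : IsMonoform H),
        ∃ hD : IsMonoform (DGMod.D hpos H),
          e (AtomSpectrum.mk H hH) = (AtomSpectrum.mk (DGMod.D hpos H) hD).toOrbit) ∧
      ∀ M : DGMod R, orbitAss M = e '' atomAss M.toZeroModule) ∧
    SuppSpecializesFromAss (DGMod R) :=
  ⟨⟨Equiv.ofBijective (DGMod.atomToOrbit hpos hbdd hcomm hnoeth.2)
      ⟨DGMod.atomToOrbit_injective hpos hbdd hcomm hnoeth.2,
        DGMod.atomToOrbit_surjective hpos hbdd hcomm hnoeth.2⟩,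
    fun _ hH => ⟨DGMod.isMonoform_D hH, rfl⟩, DGMod.orbitAss_eq hpos hbdd hcomm hnoeth.2⟩,
    DGMod.suppSpecializesFromAss hpos hbdd hcomm hnoeth.2⟩
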